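/- \textbf{Setting.} Let $J\ge1$, $N_1,\dots,N_J\ge1$ be integers, $0<r_1<\dots<r_J$, and $0<\alpha_{j,1}<\dots<\alpha_{j,N_j}<\pi$ for each $j$. Put $\lambda_{j,k}=r_je^{i\alpha_{j,k}}$, $\Lambda=\{\lambda_{j,k}\}$, and let $\Omega=\{\omega_{j,k}\}$ with $\omega_{j,k}\in\mathbb C\setminus\{0\}$. Let $D_-=\pm1$, $\sigma_3=\mathrm{diag}(1,-1)$ and $\theta(\lambda;t,z)=\lambda t-\frac{D_-}{2\lambda}z$. Let $D_a^\epsilon$ be the open disk of centre $a$ and radius $\epsilon$. \emph{Residue-form RHP at $(t,z)\in\mathbb R^2$.} Find a $2\times2$ matrix function $\mathbf M(\lambda)$, meromorphic on $\mathbb C$, analytic off $\Lambda\cup\overline\Lambda$, with at most simple poles, with $\mathbf M(\lambda)\to\mathbb I$ as $\lambda\to\infty$ and, for all $j,k$, $$\operatorname*{Res}_{\lambda=\lambda_{j,k}}\mathbf M=\lim_{\lambda\to\lambda_{j,k}}\mathbf M(\lambda)\begin{pmatrix}0&0\\ \omega_{j,k}e^{-2i\theta(\lambda;t,z)}&0\end{pmatrix},\qquad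 \operatorname*{Res}_{\lambda=\overline{\lambda_{j,k}}}\mathbf M=\lim_{\lambda\to\overline{\lambda_{j,k}}}\mathbf M(\lambda)\begin{pmatrix}0&-\overline{\omega_{j,k}}e^{2i\theta(\lambda;t,z)}\\0&0\end{pmatrix}.$$ \emph{Jump-form RHP at $(t,z)$.} Call $\epsilon>0$ admissible if the closed disks of radius $\epsilon$ centred at the points of $\Lambda\cup\overline\Lambda$ are pairwise disjoint and do not meet $\mathbb R$. Given such an $\epsilon$, find $\mathbf M(\lambda)$, analytic off the circles of radius $\epsilon$ centred at the points of $\Lambda\cup\overline\Lambda$ (oriented counterclockwise), with $\mathbf M(\lambda)\to\mathbb I$ as $\lambda\to\infty$ and with continuous boundary values $\mathbf M^+$ (from inside) and $\mathbf M^-$ (from outside) on the circles satisfying $$\mathbf M^+=\mathbf M^-\mathbf V_{j,k}(\lambda)^{-1}\ \text{ on }\partial D^\epsilon_{\lambda_{j,k}},\qquad \mathbf M^+=\mathbf M^-\mathbf V_{j,k}(\overline\lambda)^{\dagger}\ \text{ on }\partial D^\epsilon_{\overline{\lambda_{j,k}}},\qquad \mathbf V_{j,k}(\lambda)=\begin{pmatrix}1&0\\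 \frac{\omega_{j,k}e^{-2i\theta(\lambda;t,z)}}{\lambda-\lambda_{j,k}}&1\end{pmatrix}.$$ \textbf{Lemma (Reconstruction formula).} Admissible radii exist. For every $(t,z)\in\mathbb R^2$ the residue-form RHP has a unique solution $\mathbf M_R$ and, for every admissible $\epsilon$, the jump-form RHP has a unique solution $\mathbf M_J$. They correspond to each other: $\mathbf M_R=\mathbf M_J$ outside all closed disks, $\mathbf M_R(\lambda)=\mathbf M_J(\lambda)\mathbf V_{j,k}(\lambda)$ in $D^\epsilon_{\lambda_{j,k}}\setminus\{\lambda_{j,k}\}$, and $\mathbf M_R(\lambda)=\mathbf M_J(\lambda)[\mathbf V_{j,k}(\overline\lambda)^{\dagger}]^{-1}$ in $D^\epsilon_{\overline{\lambda_{j,k}}}\setminus\{\overline{\lambda_{j,k}}\}$. There is exactly one triple of functions $q,P:\mathbb R^2\to\mathbb C$, $D:\mathbb R^2\to\mathbb R$ given by the formula $$\begin{pmatrix}0&q\\-\overline q&0\end{pmatrix}=\lim_{\lambda\to\infty}i\lambda[\mathbf M(\lambda;t,z),\sigma_3],\qquad \begin{pmatrix}D&P\\ \overline P&-D\end{pmatrix}=D_-\,\mathbf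 M(0;t,z)\,\sigma_3\,\mathbf M(0;t,z)^{-1},$$ where $\mathbf M(0;t,z)$ is invertible, and it is the same triple whether $\mathbf M$ is the solution of the residue form or of the jump form (for any admissible $\epsilon$). This triple is a continuously differentiable solution of the Maxwell--Bloch equations $$q_z=-P,\qquad P_t=-2qD,\qquad D_t=2\operatorname{Re}(\overline q\,P)\qquad\text{on }\mathbb R^2,$$ and for every $z$ it satisfies $q\to0$, $P\to0$, $D\to D_-$ as $t\to-\infty$. It is called the $N$-soliton solution, $N=|\Lambda|$. -/

import Mathlib

open scoped ComplexConjugate Topology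

noncomputable section

namespace MBE

/-- Spectral data: `J ≥ 1` groups, the `j`-th one consisting of `N j ≥ 1` eigenvalues
`r j * exp (i α j k)` of common modulus `r j`, with `0 < r 1 < … < r J` and
`0 < α j 1 < … < α j (N j) < π`, together with non-zero norming constants `ω j k`. -/
structure SpectralData where
  J : ℕ
  J_pos : 1 ≤ J
  N : Fin J → ℕ
  N_pos : ∀ j, 1 ≤ N j
  r : Fin J → ℝ
  r_pos : ∀ j, 0 < r j
  r_strictMono : StrictMono r
  α : (j : Fin J) → Fin (N j) → ℝ
  α_pos : ∀ j k, 0 < α j k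
  α_lt_pi : ∀ j k, α j k < Real.pi
  α_strictMono : ∀ j, StrictMono (α j)
  ω : (j : Fin J) → Fin (N j) → ℂ
  ω_ne_zero : ∀ j k, ω j k ≠ 0

/-- `2 × 2` complex matrices. -/
abbrev Mat := Matrix (Fin 2) (Fin 2) ℂ

/-- The third Pauli matrix. -/
def σ₃ : Mat := !![1, 0; 0, -1]

/-- The phase `θ(l; t, z) = l t - D₋ z / (2 l)`. -/
def θ (Dm t z : ℝ) (l : ℂ) : ℂ := l * t - Dm / (2 * l) * z

/-- `M` has an at most simple pole at `p`, with residue `R`. -/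
def HasSimplePoleResidue (M : ℂ → Mat) (p : ℂ) (R : Mat) : Prop :=
  Filter.Tendsto (fun l => (l - p) • M l) (𝓝[≠] p) (𝓝 R)

/-- The normalization `M(l) → 𝕀` as `l → ∞`. -/
def NormalizedAtInfinity (M : ℂ → Mat) : Prop :=
  Filter.Tendsto M (Bornology.cobounded ℂ) (𝓝 1)

namespace SpectralData

variable (S : SpectralData)

/-- Eigenvalue `(j, k)`, in the upper half plane. -/
def ev (j : Fin S.J) (k : Fin (S.N j)) : ℂ :=
  (S.r j : ℂ) * Complex.exp (Complex.I * (S.α j k : ℂ))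

/-- The set `Λ` of eigenvalues in the upper half plane. -/
def Λ : Set ℂ := {l | ∃ j k, l = S.ev j k}

/-- All eigenvalues and their complex conjugates. -/
def poles : Set ℂ := {l | l ∈ S.Λ ∨ conj l ∈ S.Λ}

/-! ### The residue form -/

/-- The residue-form Riemann-Hilbert problem at the point `(t, z)`. The values of `M` at the
poles are irrelevant. -/
structure IsResidueSolution (Dm t z : ℝ) (M : ℂ → Mat) : Prop where
  meromorphic : ∀ a b, Meromorphic (fun l => M l a b)
  analytic : ∀ a b, DifferentiableOn ℂ (fun l => M l a b) S.polesᶜ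
  normalized : NormalizedAtInfinity M
  residue_upper : ∀ j k, ∃ R : Mat,
    HasSimplePoleResidue M (S.ev j k) R ∧
    Filter.Tendsto
      (fun l => M l * !![0, 0; S.ω j k * Complex.exp (-2 * Complex.I * θ Dm t z l), 0])
      (𝓝[≠] (S.ev j k)) (𝓝 R)
  residue_lower : ∀ j k, ∃ R : Mat,
    HasSimplePoleResidue M (conj (S.ev j k)) R ∧
    Filter.Tendsto
      (fun l => M l *
        !![0, -conj (S.ω j k) * Complex.exp (2 * Complex.I * θ Dm t z l); 0, 0])
      (𝓝[≠] (conj (S.ev j k))) (𝓝 R)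

/-! ### The jump form -/

/-- The radius `ε` is admissible: the closed disks of radius `ε` around the eigenvalues and
their conjugates are pairwise disjoint and do not meet the real line. -/
def Admissible (ε : ℝ) : Prop :=
  0 < ε ∧
  S.poles.PairwiseDisjoint (fun p => Metric.closedBall p ε) ∧
  ∀ p ∈ S.poles, ∀ x : ℝ, (x : ℂ) ∉ Metric.closedBall p ε

/-- The union of the circles of radius `ε` around the eigenvalues and their conjugates. -/
def contour (ε : ℝ) : Set ℂ := ⋃ p ∈ S.poles, Metric.sphere p ε

/-- The union of the closed disks of radius `ε` around the eigenvalues and their conjugates. -/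
def disks (ε : ℝ) : Set ℂ := ⋃ p ∈ S.poles, Metric.closedBall p ε

/-- The matrix `V j k (l; t, z)`. -/
def V (Dm t z : ℝ) (j : Fin S.J) (k : Fin (S.N j)) (l : ℂ) : Mat :=
  !![1, 0;
     S.ω j k * Complex.exp (-2 * Complex.I * θ Dm t z l) / (l - S.ev j k), 1]

/-- The jump-form Riemann-Hilbert problem at the point `(t, z)`. The circles are oriented
counterclockwise, so the boundary value `Mp` on the left is taken from inside the circle and
the boundary value `Mm` on the right from outside. The values of `M` on the circles are
irrelevant. -/
structure IsJumpSolution (ε Dm t z : ℝ) (M : ℂ → Mat) : Prop where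
  analytic : ∀ a b, DifferentiableOn ℂ (fun l => M l a b) (S.contour ε)ᶜ
  normalized : NormalizedAtInfinity M
  jump : ∃ Mp Mm : ℂ → Mat,
    ContinuousOn Mp (S.contour ε) ∧ ContinuousOn Mm (S.contour ε) ∧
    (∀ p ∈ S.poles, ∀ ζ ∈ Metric.sphere p ε,
      Filter.Tendsto M (𝓝[Metric.ball p ε] ζ) (𝓝 (Mp ζ)) ∧
      Filter.Tendsto M (𝓝[(S.disks ε)ᶜ] ζ) (𝓝 (Mm ζ))) ∧
    (∀ j k, ∀ ζ ∈ Metric.sphere (S.ev j k) ε,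
      Mp ζ = Mm ζ * (S.V Dm t z j k ζ)⁻¹) ∧
    (∀ j k, ∀ ζ ∈ Metric.sphere (conj (S.ev j k)) ε,
      Mp ζ = Mm ζ * (S.V Dm t z j k (conj ζ)).conjTranspose)

/-- The correspondence between a function `Mr` as in the residue form and a function `Mj` as
in the jump form: they agree outside the closed disks, and differ by the triangular factors
inside the disks. -/
structure Corresponds (ε Dm t z : ℝ) (Mr Mj : ℂ → Mat) : Prop where
  outside : ∀ l ∉ S.disks ε, Mr l = Mj l
  upper : ∀ j k, ∀ l ∈ Metric.ball (S.ev j k) ε, l ≠ S.ev j k →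
    Mr l = Mj l * S.V Dm t z j k l
  lower : ∀ j k, ∀ l ∈ Metric.ball (conj (S.ev j k)) ε, l ≠ conj (S.ev j k) →
    Mr l = Mj l * ((S.V Dm t z j k (conj l)).conjTranspose)⁻¹

end SpectralData

/-! ### The Maxwell-Bloch equations -/

/-- A triple of functions `q(t, z)`, `D(t, z)`, `P(t, z)`. -/
@[ext] structure Fields where
  q : ℝ → ℝ → ℂ
  D : ℝ → ℝ → ℝ
  P : ℝ → ℝ → ℂ

/-- Classical (continuously differentiable) solutions of the sharp-line Maxwell-Bloch
equations `q_z = -P`, `P_t = -2 q D`, `D_t = 2 Re (conj q * P)` on the whole `(t, z)`-plane. -/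
structure Fields.SolvesMBE (s : Fields) : Prop where
  smooth_q : ContDiff ℝ 1 (fun x : ℝ × ℝ => s.q x.1 x.2)
  smooth_D : ContDiff ℝ 1 (fun x : ℝ × ℝ => s.D x.1 x.2)
  smooth_P : ContDiff ℝ 1 (fun x : ℝ × ℝ => s.P x.1 x.2)
  q_z : ∀ t z, HasDerivAt (fun z' => s.q t z') (-s.P t z) z
  P_t : ∀ t z, HasDerivAt (fun t' => s.P t' z) (-2 * s.q t z * (s.D t z : ℂ)) t
  D_t : ∀ t z, HasDerivAt (fun t' => s.D t' z) (2 * (conj (s.q t z) * s.P t z).re) t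

/-- The boundary conditions `q → 0`, `P → 0`, `D → D₋` as `t → -∞`, for every `z`. -/
structure Fields.HasBoundaryValues (s : Fields) (Dm : ℝ) : Prop where
  q_lim : ∀ z, Filter.Tendsto (fun t => s.q t z) Filter.atBot (𝓝 0)
  P_lim : ∀ z, Filter.Tendsto (fun t => s.P t z) Filter.atBot (𝓝 0)
  D_lim : ∀ z, Filter.Tendsto (fun t => s.D t z) Filter.atBot (𝓝 Dm)

/-- The matrix `Q` of the Lax pair. -/
def Fields.Q (s : Fields) (t z : ℝ) : Mat := !![0, s.q t z; -conj (s.q t z), 0]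

/-- The matrix `ρ` of the Lax pair. -/
def Fields.ρ (s : Fields) (t z : ℝ) : Mat :=
  !![(s.D t z : ℂ), s.P t z; conj (s.P t z), -(s.D t z : ℂ)]

/-- The reconstruction formula at `(t, z)`: `Q = lim i l [M(l), σ₃]` as `l → ∞`, and
`ρ = D₋ M(0) σ₃ M(0)⁻¹`, where `M(0)` is invertible. -/
def Fields.ReconstructedAt (s : Fields) (Dm t z : ℝ) (M : ℂ → Mat) : Prop :=
  Filter.Tendsto (fun l : ℂ => (Complex.I * l) • (M l * σ₃ - σ₃ * M l))
    (Bornology.cobounded ℂ) (𝓝 (s.Q t z)) ∧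
  IsUnit (M 0) ∧
  s.ρ t z = (Dm : ℂ) • (M 0 * σ₃ * (M 0)⁻¹)

/-- `s` is obtained by the reconstruction formula from solutions of the residue form. -/
def SpectralData.ReconstructsFromResidue (S : SpectralData) (Dm : ℝ) (s : Fields) : Prop :=
  ∀ t z, ∃ M, S.IsResidueSolution Dm t z M ∧ s.ReconstructedAt Dm t z M

/-- `s` is obtained by the reconstruction formula from solutions of the jump form. -/
def SpectralData.ReconstructsFromJump (S : SpectralData) (ε Dm : ℝ) (s : Fields) : Prop :=
  ∀ t z, ∃ M, S.IsJumpSolution ε Dm t z M ∧ s.ReconstructedAt Dm t z M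

end MBE

end

/-! By Liouville, the rows of a residue-form solution are rational: the first entry is a constant
plus simple poles at the `λ_j` with residues `A_j`, the second a constant plus simple poles at the
conjugates with residues `B_j`. The residue conditions become a linear system for `(A, B)` with
coefficients built from `c_j = ω_j exp(-2iθ(λ_j))`. Existence and uniqueness both reduce to its
invertibility, `residue_system_injective`, which is a positivity statement: `i/(λ_j - conj λ_k)` is
the Gram matrix of the functions `exp(iλ_j s)` on `(0, ∞)`, and a homogeneous solution makes one
value of its quadratic form equal to minus another.

Cramer's rule makes the residues smooth in `(t, z)`. Their derivatives solve the differentiated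
system, and so do the expressions predicted by the Lax pair; injectivity identifies the two
(`residues_deriv_t`, `residues_deriv_z`). The `z`-part also uses `det M(0) = 1` (`origin_unitary`).
The Maxwell-Bloch equations follow by summing residues or evaluating at `0`. As `t → -∞` all `c_j`
tend to `0`, which gives the boundary values.

The residue condition at a pole `p` makes the singularity at `p` of `M` times an inverse triangular
factor removable. The jump condition on the circle around `p` says that this product continues the
inner function continuously, hence holomorphically
(`differentiableOn_ball_of_continuousOn_of_off_sphere`). So the two problems are exchanged by
multiplication with the factors inside the disks. The reconstruction sees only `0` and a
neighbourhood of infinity, where both solutions agree. -/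

open scoped ComplexConjugate Topology
open Filter Set

/-! ### Removable singularities, Liouville's theorem and continuation across a circle -/

section

open Metric

/-- A function holomorphic on a punctured neighbourhood of `p`, with `(l - p) f l → 0`, extends. -/
theorem exists_differentiableOn_extension {f : ℂ → ℂ} {U : Set ℂ} {p : ℂ} (hU : U ∈ 𝓝 p)
    (hf : DifferentiableOn ℂ f (U \ {p}))
    (h0 : Tendsto (fun l => (l - p) * f l) (𝓝[≠] p) (𝓝 0)) :
    ∃ g : ℂ → ℂ, DifferentiableOn ℂ g U ∧ ∀ l, l ≠ p → g l = f l := by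
  refine ⟨_, Complex.differentiableOn_update_limUnder_of_isLittleO hU hf ?_, fun l hl => ?_⟩
  -- The removability criterion concerns `f l - f p`. The value `f p` is arbitrary, but `(l - p) * f
  -- p` tends to `0` anyway.
  · rw [Asymptotics.isLittleO_iff_tendsto']
    · have h1 : Tendsto (fun l => (l - p) * f p) (𝓝[≠] p) (𝓝 0) := by
        have : Tendsto (fun l => (l - p) * f p) (𝓝 p) (𝓝 ((p - p) * f p)) :=
          Continuous.tendsto (by fun_prop) p
        rw [sub_self, zero_mul] at this
        exact this.mono_left nhdsWithin_le_nhds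
      have h2 := h0.sub h1
      rw [sub_zero] at h2
      refine h2.congr fun l => ?_
      rw [div_inv_eq_mul]; ring
    · filter_upwards [self_mem_nhdsWithin] with l hl h
      exact absurd (inv_eq_zero.mp h) (sub_ne_zero.mpr hl)
  · simp [Function.update_of_ne hl]

/-- Removal of finitely many singularities. -/
theorem exists_entire_extension {s : Set ℂ} (hs : s.Finite) :
    ∀ {f : ℂ → ℂ}, DifferentiableOn ℂ f sᶜ →
    (∀ p ∈ s, Tendsto (fun l => (l - p) * f l) (𝓝[≠] p) (𝓝 0)) →
    ∃ g : ℂ → ℂ, Differentiable ℂ g ∧ EqOn g f sᶜ := by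
  induction s, hs using Set.Finite.induction_on with
  | empty =>
    intro f hf _
    exact ⟨f, by simpa [differentiableOn_univ] using hf, fun _ _ => rfl⟩
  | @insert p s hp hs ih =>
    intro f hf h0
    have hopen : IsOpen sᶜ := hs.isClosed.isOpen_compl
    have hdiff : sᶜ \ {p} = (insert p s)ᶜ := by
      ext x; simp [and_comm]
    obtain ⟨g, hg, hgf⟩ := exists_differentiableOn_extension (hopen.mem_nhds hp)
      (hdiff ▸ hf) (h0 p (mem_insert _ _))
    obtain ⟨G, hG, hGg⟩ := ih hg fun q hq => by
      have hqp : q ≠ p := fun h => hp (h ▸ hq)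
      refine (h0 q (mem_insert_of_mem _ hq)).congr' ?_
      filter_upwards [mem_nhdsWithin_of_mem_nhds (isOpen_ne.mem_nhds hqp)] with l hl
      rw [hgf l hl]
    refine ⟨G, hG, fun l hl => ?_⟩
    rw [mem_compl_iff, mem_insert_iff, not_or] at hl
    rw [hGg hl.2, hgf l hl.1]

theorem Set.Finite.eventually_cobounded_notMem {s : Set ℂ} (hs : s.Finite) :
    ∀ᶠ l in Bornology.cobounded ℂ, l ∉ s :=
  hs.isBounded

/-- Liouville's theorem, once the finitely many singularities are filled in. All uniqueness
statements go back to this. -/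
theorem eq_zero_of_removable_of_tendsto_zero {s : Set ℂ} (hs : s.Finite) {f : ℂ → ℂ}
    (hf : DifferentiableOn ℂ f sᶜ)
    (h0 : ∀ p ∈ s, Tendsto (fun l => (l - p) * f l) (𝓝[≠] p) (𝓝 0))
    (hinf : Tendsto f (Bornology.cobounded ℂ) (𝓝 0)) {l : ℂ} (hl : l ∉ s) : f l = 0 := by
  obtain ⟨g, hg, hgf⟩ := exists_entire_extension hs hf h0
  rw [← hgf hl]
  refine hg.apply_eq_of_tendsto_cocompact l ?_
  rw [← Metric.cobounded_eq_cocompact]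
  refine hinf.congr' ?_
  filter_upwards [hs.eventually_cobounded_notMem] with x hx
  exact (hgf hx).symm

/-- A continuous function that is holomorphic off a circle is holomorphic. -/
theorem differentiableOn_ball_of_continuousOn_of_off_sphere {f : ℂ → ℂ} {c : ℂ} {r R : ℝ}
    (hr : 0 < r) (hrR : r < R) (hc : ContinuousOn f (closedBall c R))
    (hd : ∀ l ∈ ball c R, l ∉ sphere c r → DifferentiableAt ℂ f l) :
    DifferentiableOn ℂ f (ball c R) := by
  have hR : 0 < R := hr.trans hrR
  have cauchy : ∀ w ∈ ball c R, w ∉ sphere c r →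
      (2 * Real.pi * Complex.I : ℂ)⁻¹ • ∮ z in C(c, R), (z - w)⁻¹ • f z = f w := by
    intro w hw hws
    -- The difference quotient is continuous at `w` because `w` lies off the singular circle, so `f`
    -- is differentiable there.
    have hcw : ContinuousOn (dslope f w) (closedBall c R) :=
      (continuousOn_dslope (closedBall_mem_nhds_of_mem hw)).2 ⟨hc, hd w hw hws⟩
    have hdw : ∀ l ∈ ball c R, l ∉ sphere c r → l ≠ w → DifferentiableAt ℂ (dslope f w) l :=
      fun l hl hls hlw => (differentiableAt_dslope_of_ne hlw).2 (hd l hl hls)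
    -- Cauchy's theorem on the annulus and then on the inner disk. Both versions ask only for
    -- continuity on the boundary circles and tolerate the exceptional point `w`.
    have h1 : (∮ z in C(c, R), dslope f w z) = ∮ z in C(c, r), dslope f w z := by
      refine Complex.circleIntegral_eq_of_differentiable_on_annulus_off_countable hr hrR.le
        (countable_singleton w) (hcw.mono sdiff_subset) fun l hl => hdw l hl.1.1 ?_ hl.2
      exact fun h => hl.1.2 (sphere_subset_closedBall h)
    have h2 : (∮ z in C(c, r), dslope f w z) = 0 := by
      refine Complex.circleIntegral_eq_zero_of_differentiable_on_off_countable hr.le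
        (countable_singleton w) (hcw.mono (closedBall_subset_closedBall hrR.le))
        fun l hl => hdw l (ball_subset_ball hrR.le hl.1) ?_ hl.2
      exact fun h => (ne_of_lt (mem_ball.1 hl.1)) (mem_sphere.1 h)
    have hne : ∀ z ∈ sphere c R, z ≠ w := fun z hz h => by
      subst h; exact (ne_of_lt (mem_ball.1 hw)) (mem_sphere.1 hz)
    have hinv : ContinuousOn (fun z => (z - w)⁻¹) (sphere c R) :=
      (continuousOn_id.sub continuousOn_const).inv₀ fun z hz => sub_ne_zero.2 (hne z hz)
    have h3 : (∮ z in C(c, R), dslope f w z) =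
        (∮ z in C(c, R), (z - w)⁻¹ • f z) - ∮ z in C(c, R), (z - w)⁻¹ • f w := by
      rw [← circleIntegral.integral_sub]
      · refine circleIntegral.integral_congr hR.le fun z hz => ?_
        simp only [dslope_of_ne _ (hne z hz), slope, vsub_eq_sub, smul_sub]
      · exact (hinv.smul (hc.mono sphere_subset_closedBall)).circleIntegrable hR.le
      · exact (hinv.smul continuousOn_const).circleIntegrable hR.le
    rw [h1, h2, circleIntegral.integral_smul_const, circleIntegral.integral_sub_inv_of_mem_ball hw]
      at h3
    rw [sub_eq_zero.1 h3.symm, smul_smul, inv_mul_cancel₀ Complex.two_pi_I_ne_zero, one_smul]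
  set F : ℂ → ℂ := fun w => (2 * Real.pi * Complex.I : ℂ)⁻¹ • ∮ z in C(c, R), (z - w)⁻¹ • f z
  lift R to NNReal using hR.le
  have hint : CircleIntegrable f c R := (hc.mono sphere_subset_closedBall).circleIntegrable hR.le
  have hF : DifferentiableOn ℂ F (ball c R) := by
    have := (hasFPowerSeriesOn_cauchy_integral hint (by exact_mod_cast hR)).differentiableOn
    rwa [Metric.eball_coe] at this
  refine hF.congr fun w hw => ?_
  -- On the circle, `f` and its Cauchy integral are both continuous, so they agree as limits from
  -- inside.
  by_cases hws : w ∈ sphere c r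
  · have hclos : w ∈ closure (ball c r) := by
      rw [closure_ball _ hr.ne']; exact sphere_subset_closedBall hws
    have hne : (𝓝[ball c r] w).NeBot := mem_closure_iff_nhdsWithin_neBot.1 hclos
    have t1 : Tendsto f (𝓝[ball c r] w) (𝓝 (f w)) :=
      (hc.continuousAt (closedBall_mem_nhds_of_mem hw)).tendsto.mono_left nhdsWithin_le_nhds
    have t2 : Tendsto F (𝓝[ball c r] w) (𝓝 (F w)) :=
      ((hF.continuousOn).continuousAt (isOpen_ball.mem_nhds hw)).tendsto.mono_left
        nhdsWithin_le_nhds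
    refine tendsto_nhds_unique t1 (t2.congr' ?_)
    filter_upwards [self_mem_nhdsWithin] with z hz
    exact cauchy z (ball_subset_ball hrR.le hz) fun h => (ne_of_lt (mem_ball.1 hz)) (mem_sphere.1 h)
  · exact (cauchy w hw hws).symm

end

/-! ### The Cauchy Gram matrix and the linear system for the residues -/

section

open scoped Matrix ComplexOrder

namespace MBE

variable {ι : Type*} [Fintype ι]

/-- The Hermitian Cauchy matrix `i / (lam j - conj (lam k))`. -/
noncomputable def cauchyGram (lam : ι → ℂ) : Matrix ι ι ℂ :=
  Matrix.of fun j k => Complex.I / (lam j - conj (lam k))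

/-- The entries are the inner products `∫ exp(i λ_j s) conj (exp(i λ_k s)) ds` over `(0, ∞)`,
convergent because `Im λ > 0`. The quadratic form is therefore the integral of `|g|²`, with `g` a
combination of these exponentials. -/
theorem cauchyGram_posSemidef {lam : ι → ℂ} (hlam : ∀ i, 0 < (lam i).im) :
    (cauchyGram lam).PosSemidef := by
  refine Matrix.PosSemidef.of_dotProduct_mulVec_nonneg ?_ fun x => ?_
  · ext j k
    simp only [cauchyGram, Matrix.conjTranspose_apply, Matrix.of_apply, RCLike.star_def, map_div₀,
      map_sub, Complex.conj_I, Complex.conj_conj]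
    rw [← neg_div_neg_eq, neg_neg, neg_sub]
  · let e : ι → ℝ → ℂ := fun j s => Complex.exp (Complex.I * lam j * s)
    let g : ℝ → ℂ := fun s => ∑ j, conj (x j) * e j s
    have hre : ∀ j k, (Complex.I * (lam j - conj (lam k))).re < 0 := fun j k => by
      simp; linarith [hlam j, hlam k]
    have hmul : ∀ j k (s : ℝ), e j s * conj (e k s) =
        Complex.exp (Complex.I * (lam j - conj (lam k)) * s) := fun j k s => by
      simp only [e]
      rw [← Complex.exp_conj, ← Complex.exp_add]
      congr 1
      simp; ring
    have hint : ∀ j k, MeasureTheory.IntegrableOn (fun s => e j s * conj (e k s)) (Ioi 0) :=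
      fun j k => by
        simp only [hmul]
        exact integrableOn_exp_mul_complex_Ioi (hre j k) 0
    have hval : ∀ j k, ∫ s in Ioi (0 : ℝ), e j s * conj (e k s) = cauchyGram lam j k := by
      intro j k
      simp only [hmul]
      rw [integral_exp_mul_complex_Ioi (hre j k) 0]
      have : lam j - conj (lam k) ≠ 0 := fun h => by
        have := hre j k; rw [h] at this; simp at this
      simp only [cauchyGram, Matrix.of_apply]
      field_simp
      simp
    have key : star x ⬝ᵥ (cauchyGram lam *ᵥ x) = ∫ s in Ioi (0 : ℝ), g s * conj (g s) := by
      have : ∀ s, g s * conj (g s) = ∑ j, ∑ k, (conj (x j) * x k) * (e j s * conj (e k s)) := by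
        intro s
        simp only [g, map_sum, Finset.sum_mul_sum, map_mul, Complex.conj_conj]
        refine Finset.sum_congr rfl fun j _ => Finset.sum_congr rfl fun k _ => ?_
        ring
      simp only [this]
      rw [MeasureTheory.integral_finsetSum _ fun j _ =>
        MeasureTheory.integrable_finsetSum _ fun k _ => (hint j k).const_mul _]
      simp only [dotProduct, Matrix.mulVec, Finset.mul_sum]
      refine Finset.sum_congr rfl fun j _ => ?_
      rw [MeasureTheory.integral_finsetSum _ fun k _ => (hint j k).const_mul _]
      refine Finset.sum_congr rfl fun k _ => ?_
      rw [MeasureTheory.integral_const_mul, hval]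
      simp; ring
    rw [key]
    have : ∀ s, g s * conj (g s) = ((Complex.normSq (g s) : ℝ) : ℂ) := fun s => Complex.mul_conj _
    simp only [this]
    rw [integral_complex_ofReal]
    exact_mod_cast MeasureTheory.integral_nonneg fun s => Complex.normSq_nonneg _

/-- The homogeneous linear system for the residues has only the trivial solution. -/
theorem residue_system_injective {lam : ι → ℂ} (hlam : ∀ i, 0 < (lam i).im) {c A B : ι → ℂ}
    (hA : ∀ j, A j = c j * ∑ k, B k / (lam j - conj (lam k)))
    (hB : ∀ j, B j = -conj (c j) * ∑ k, A k / (conj (lam j) - lam k)) :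
    A = 0 ∧ B = 0 := by
  classical
  have hG := cauchyGram_posSemidef hlam
  set G := cauchyGram lam
  -- Elimination of `B`: the second equation reads `B = -i u`, and then the first reads `A_j = -c_j
  -- (G u)_j`.
  set y : ι → ℂ := Gᵀ *ᵥ A
  set u : ι → ℂ := fun j => conj (c j) * y j
  have hBu : ∀ j, B j = -Complex.I * u j := by
    intro j
    rw [hB j]
    simp only [u, y, Matrix.mulVec, dotProduct, Finset.mul_sum, G, cauchyGram,
      Matrix.transpose_apply, Matrix.of_apply]
    refine Finset.sum_congr rfl fun k _ => ?_
    rw [← neg_sub (lam k) (conj (lam j)), div_neg]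
    linear_combination (conj (c j)) * A k / (lam k - conj (lam j)) * Complex.I_sq
  have hAu : ∀ j, A j = -(c j * (G *ᵥ u) j) := by
    intro j
    rw [hA j]
    simp only [Matrix.mulVec, dotProduct, Finset.mul_sum, G, cauchyGram, Matrix.of_apply, hBu]
    rw [← Finset.sum_neg_distrib]
    refine Finset.sum_congr rfl fun k _ => ?_
    ring
  -- The coefficient `c_j` moves from one factor of the pairing to the other. The left side is
  -- nonnegative and the right side nonpositive, so both vanish.
  have h1 : star A ⬝ᵥ (Gᵀ *ᵥ A) = -conj (star u ⬝ᵥ (G *ᵥ u)) := by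
    simp only [dotProduct, map_sum, ← Finset.sum_neg_distrib]
    refine Finset.sum_congr rfl fun j _ => ?_
    have : (Gᵀ *ᵥ A) j = y j := rfl
    rw [this, Pi.star_apply, Pi.star_apply, hAu j]
    simp [u]; ring
  have p1 := hG.transpose.dotProduct_mulVec_nonneg A
  have p2 := hG.dotProduct_mulVec_nonneg u
  have h0 : star A ⬝ᵥ (Gᵀ *ᵥ A) = 0 := by
    refine le_antisymm ?_ p1
    rw [h1, neg_nonpos]
    have := star_nonneg_iff.2 p2
    simpa using this
  -- Semidefiniteness is enough: a null vector of the form lies in the kernel of `Gᵀ`, so `u = 0`,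
  -- and `A` and `B` are both expressed through `u`.
  have hy : y = 0 := (hG.transpose.dotProduct_mulVec_zero_iff A).1 h0
  have hu : u = 0 := by ext j; simp [u, hy]
  constructor
  · ext j; simp [hAu j, hu]
  · ext j; simp [hBu j, hu]

variable [DecidableEq ι]

/-- The matrix of the linear system for the residues of the soliton solution. -/
noncomputable def residueMatrix (lam c : ι → ℂ) : Matrix (ι ⊕ ι) (ι ⊕ ι) ℂ :=
  Matrix.fromBlocks 1 (Matrix.of fun j k => -(c j / (lam j - conj (lam k))))
    (Matrix.of fun j k => conj (c j) / (conj (lam j) - lam k)) 1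

/-- The right-hand side of the linear system for the residues. -/
noncomputable def residueVector (c : ι → ℂ) : ι ⊕ ι → ℂ := Sum.elim 0 fun j => -conj (c j)

/-- The residues of the first row of the soliton solution. -/
noncomputable def residues (lam c : ι → ℂ) : ι ⊕ ι → ℂ :=
  fun x => (residueMatrix lam c).det⁻¹ * (residueMatrix lam c).cramer (residueVector c) x

/-- Residues of the `(1, 1)` entry at the points `lam`. -/
noncomputable def resA (lam c : ι → ℂ) (j : ι) : ℂ := residues lam c (Sum.inl j)

/-- Residues of the `(1, 2)` entry at the points `conj lam`. -/
noncomputable def resB (lam c : ι → ℂ) (j : ι) : ℂ := residues lam c (Sum.inr j)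

theorem residueMatrix_mulVec_inl (lam c : ι → ℂ) (X : ι ⊕ ι → ℂ) (j : ι) :
    (residueMatrix lam c *ᵥ X) (Sum.inl j) =
      X (Sum.inl j) - c j * ∑ k, X (Sum.inr k) / (lam j - conj (lam k)) := by
  rw [residueMatrix, Matrix.fromBlocks_mulVec, Sum.elim_inl, Pi.add_apply, Matrix.one_mulVec,
    sub_eq_add_neg, Finset.mul_sum, ← Finset.sum_neg_distrib]
  simp only [Matrix.mulVec, dotProduct, Matrix.of_apply, Function.comp]
  congr 1
  exact Finset.sum_congr rfl fun k _ => by ring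

theorem residueMatrix_mulVec_inr (lam c : ι → ℂ) (X : ι ⊕ ι → ℂ) (j : ι) :
    (residueMatrix lam c *ᵥ X) (Sum.inr j) =
      X (Sum.inr j) + conj (c j) * ∑ k, X (Sum.inl k) / (conj (lam j) - lam k) := by
  rw [residueMatrix, Matrix.fromBlocks_mulVec, Sum.elim_inr, Pi.add_apply, Matrix.one_mulVec,
    add_comm, Finset.mul_sum]
  simp only [Matrix.mulVec, dotProduct, Matrix.of_apply, Function.comp]
  congr 1
  exact Finset.sum_congr rfl fun k _ => by ring

theorem residueMatrix_det_ne_zero {lam : ι → ℂ} (hlam : ∀ i, 0 < (lam i).im) (c : ι → ℂ) :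
    (residueMatrix lam c).det ≠ 0 := by
  intro h
  obtain ⟨X, hX, h0⟩ := Matrix.exists_mulVec_eq_zero_iff.2 h
  obtain ⟨hA, hB⟩ := residue_system_injective hlam (c := c) (A := fun j => X (Sum.inl j))
    (B := fun j => X (Sum.inr j))
    (fun j => by
      have := residueMatrix_mulVec_inl lam c X j
      rw [h0, Pi.zero_apply] at this
      exact (sub_eq_zero.1 this.symm))
    (fun j => by
      have := residueMatrix_mulVec_inr lam c X j
      rw [h0, Pi.zero_apply] at this
      linear_combination -this)
  refine hX (funext fun x => ?_)
  rcases x with j | j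
  exacts [congrFun hA j, congrFun hB j]

theorem residueMatrix_mulVec_residues {lam : ι → ℂ} (hlam : ∀ i, 0 < (lam i).im) (c : ι → ℂ) :
    residueMatrix lam c *ᵥ residues lam c = residueVector c := by
  have : residues lam c =
      (residueMatrix lam c).det⁻¹ • (residueMatrix lam c).cramer (residueVector c) := rfl
  rw [this, Matrix.mulVec_smul, Matrix.mulVec_cramer, smul_smul,
    inv_mul_cancel₀ (residueMatrix_det_ne_zero hlam c), one_smul]

/-- The residue condition at `lam j` for the first row. The condition at the conjugate point,
`resB_eq`, carries an extra `1`, the value of the `(1, 1)` entry at infinity. -/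
theorem resA_eq {lam : ι → ℂ} (hlam : ∀ i, 0 < (lam i).im) (c : ι → ℂ) (j : ι) :
    resA lam c j = c j * ∑ k, resB lam c k / (lam j - conj (lam k)) := by
  have := residueMatrix_mulVec_inl lam c (residues lam c) j
  rw [residueMatrix_mulVec_residues hlam] at this
  exact sub_eq_zero.1 this.symm

theorem resB_eq {lam : ι → ℂ} (hlam : ∀ i, 0 < (lam i).im) (c : ι → ℂ) (j : ι) :
    resB lam c j = -conj (c j) * (1 + ∑ k, resA lam c k / (conj (lam j) - lam k)) := by
  have := residueMatrix_mulVec_inr lam c (residues lam c) j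
  rw [residueMatrix_mulVec_residues hlam, residueVector, Sum.elim_inr] at this
  simp only [resA, resB]
  linear_combination -this

theorem residues_zero (lam : ι → ℂ) (x : ι ⊕ ι) : residues lam 0 x = 0 := by
  have : residueVector (0 : ι → ℂ) = 0 := by
    ext (j | j) <;> simp [residueVector]
  simp [residues, this]

theorem contDiff_det {E κ : Type*} [NormedAddCommGroup E] [NormedSpace ℝ E] [Fintype κ]
    [DecidableEq κ] {n : WithTop ℕ∞} {M : E → Matrix κ κ ℂ}
    (hM : ∀ a b, ContDiff ℝ n fun x => M x a b) : ContDiff ℝ n fun x => (M x).det := by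
  simp only [Matrix.det_apply']
  exact ContDiff.sum fun σ _ => contDiff_const.mul (contDiff_prod fun i _ => hM _ _)

/-- By Cramer's rule the residues are quotients of polynomials in the `c i` and their conjugates,
with a denominator that never vanishes. Smoothness is over `ℝ` because of the conjugates. -/
theorem contDiff_residues {E : Type*} [NormedAddCommGroup E] [NormedSpace ℝ E] {n : WithTop ℕ∞}
    {lam : ι → ℂ} (hlam : ∀ i, 0 < (lam i).im) {c : E → ι → ℂ}
    (hc : ∀ i, ContDiff ℝ n fun x => c x i) (x : ι ⊕ ι) :
    ContDiff ℝ n fun y => residues lam (c y) x := by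
  have hconj : ∀ i, ContDiff ℝ n fun y => conj (c y i) := fun i =>
    Complex.conjCLE.contDiff.comp (hc i)
  have hM : ∀ a b, ContDiff ℝ n fun y => residueMatrix lam (c y) a b := by
    rintro (a | a) (b | b)
    · exact contDiff_const
    · exact ((hc a).div_const _).neg
    · exact (hconj a).div_const _
    · exact contDiff_const
  have hv : ∀ a, ContDiff ℝ n fun y => residueVector (c y) a := by
    rintro (a | a)
    · exact contDiff_const
    · exact (hconj a).neg
  refine ((contDiff_det hM).inv fun y => residueMatrix_det_ne_zero hlam _).mul ?_
  simp only [Matrix.cramer_apply]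
  refine contDiff_det fun a b => ?_
  by_cases h : b = x
  · subst h; simpa using hv a
  · simpa [Matrix.updateCol_ne h] using hM a b

end MBE

end

/-! ### The determinant at the origin and the Lax pair for the residues -/

namespace MBE

variable {ι : Type*} [Fintype ι] [DecidableEq ι] {lam : ι → ℂ}

theorem conj_resA (hlam : ∀ i, 0 < (lam i).im) (c : ι → ℂ) (j : ι) :
    conj (resA lam c j) = conj (c j) * ∑ k, conj (resB lam c k) / (conj (lam j) - lam k) := by
  rw [resA_eq hlam]; simp

theorem conj_resB (hlam : ∀ i, 0 < (lam i).im) (c : ι → ℂ) (j : ι) :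
    conj (resB lam c j) = -c j * (1 + ∑ k, conj (resA lam c k) / (lam j - conj (lam k))) := by
  rw [resB_eq hlam]; simp

omit [Fintype ι] [DecidableEq ι] in
theorem sub_conj_ne_zero (hlam : ∀ i, 0 < (lam i).im) (j k : ι) : lam j - conj (lam k) ≠ 0 :=
  fun h => by
    have := congrArg Complex.im h
    simp at this; linarith [hlam j, hlam k]

omit [Fintype ι] [DecidableEq ι] in
theorem conj_sub_ne_zero (hlam : ∀ i, 0 < (lam i).im) (j k : ι) : conj (lam j) - lam k ≠ 0 :=
  fun h => sub_conj_ne_zero hlam k j (by linear_combination -h)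

omit [Fintype ι] [DecidableEq ι] in
theorem lam_ne_zero (hlam : ∀ i, 0 < (lam i).im) (j : ι) : lam j ≠ 0 :=
  fun h => by have := hlam j; simp [h] at this

omit [Fintype ι] [DecidableEq ι] in
theorem conj_lam_ne_zero (hlam : ∀ i, 0 < (lam i).im) (j : ι) : conj (lam j) ≠ 0 :=
  (map_ne_zero _).2 (lam_ne_zero hlam j)

/-- The `(1, 1)` entry of the soliton solution at `0`. -/
noncomputable def originA (lam c : ι → ℂ) : ℂ := 1 - ∑ k, resA lam c k / lam k

/-- The `(1, 2)` entry of the soliton solution at `0`. -/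
noncomputable def originB (lam c : ι → ℂ) : ℂ := -∑ k, resB lam c k / conj (lam k)

/-- The potential reconstructed from the norming constants `c`. -/
noncomputable def potential (lam c : ι → ℂ) : ℂ := -2 * Complex.I * ∑ k, resB lam c k

/-- The soliton solution has determinant `1` at the origin. -/
theorem origin_unitary (hlam : ∀ i, 0 < (lam i).im) (c : ι → ℂ) :
    originA lam c * conj (originA lam c) + originB lam c * conj (originB lam c) = 1 := by
  set A := resA lam c
  set B := resB lam c
  -- The double sum with denominators `λ_j conj λ_k` is computed twice. In `h3` partial fractions
  -- split it into two sums, each collapsed by the residue equations (`h1`, `h2`); in `h4` it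
  -- factors. Comparison gives the claim.
  have h1 : ∀ j, ∑ k, (A j * conj (A k) + conj (B j) * B k) / (lam j * (lam j - conj (lam k))) =
      - (A j / lam j) := fun j => by
    have hl := lam_ne_zero hlam j
    have e : ∑ k, (A j * conj (A k) + conj (B j) * B k) / (lam j * (lam j - conj (lam k))) =
        (A j * ∑ k, conj (A k) / (lam j - conj (lam k)) +
          conj (B j) * ∑ k, B k / (lam j - conj (lam k))) / lam j := by
      simp only [Finset.mul_sum, ← Finset.sum_add_distrib, Finset.sum_div]
      refine Finset.sum_congr rfl fun k _ => ?_
      have := sub_conj_ne_zero hlam j k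
      field_simp
    rw [e, ← neg_div]
    congr 1
    have hA := resA_eq hlam c j
    have hB := conj_resB hlam c j
    linear_combination (∑ k, conj (A k) / (lam j - conj (lam k)) + 1) * hA +
      (∑ k, B k / (lam j - conj (lam k))) * hB
  have h2 : ∀ k, ∑ j, (A j * conj (A k) + conj (B j) * B k) /
      (conj (lam k) * (lam j - conj (lam k))) = conj (A k) / conj (lam k) := fun k => by
    have hl := conj_lam_ne_zero hlam k
    have e : ∑ j, (A j * conj (A k) + conj (B j) * B k) /
        (conj (lam k) * (lam j - conj (lam k))) =
        (-(conj (A k) * ∑ j, A j / (conj (lam k) - lam j)) -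
          B k * ∑ j, conj (B j) / (conj (lam k) - lam j)) / conj (lam k) := by
      simp only [Finset.mul_sum, ← Finset.sum_neg_distrib, ← Finset.sum_sub_distrib,
        Finset.sum_div]
      refine Finset.sum_congr rfl fun j _ => ?_
      have h3 := sub_conj_ne_zero hlam j k
      have h4 := conj_sub_ne_zero hlam k j
      field_simp
      ring
    rw [e]
    congr 1
    have hA := conj_resA hlam c k
    have hB := resB_eq hlam c k
    linear_combination -(∑ j, A j / (conj (lam k) - lam j) + 1) * hA -
      (∑ j, conj (B j) / (conj (lam k) - lam j)) * hB
  have h3 : ∑ j, ∑ k, (A j * conj (A k) + conj (B j) * B k) / (lam j * conj (lam k)) =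
      ∑ k, conj (A k) / conj (lam k) + ∑ j, A j / lam j := by
    have e : ∀ j k, (A j * conj (A k) + conj (B j) * B k) / (lam j * conj (lam k)) =
        (A j * conj (A k) + conj (B j) * B k) / (conj (lam k) * (lam j - conj (lam k))) -
        (A j * conj (A k) + conj (B j) * B k) / (lam j * (lam j - conj (lam k))) := fun j k => by
      have n1 := lam_ne_zero hlam j
      have n2 := conj_lam_ne_zero hlam k
      have n3 := sub_conj_ne_zero hlam j k
      field_simp
    simp only [e, Finset.sum_sub_distrib]
    rw [Finset.sum_comm]
    simp only [h1, h2, Finset.sum_neg_distrib]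
    ring
  have h4 : ∑ j, ∑ k, (A j * conj (A k) + conj (B j) * B k) / (lam j * conj (lam k)) =
      (∑ j, A j / lam j) * (∑ k, conj (A k) / conj (lam k)) +
      (∑ j, conj (B j) / lam j) * (∑ k, B k / conj (lam k)) := by
    simp only [Finset.sum_mul_sum, ← Finset.sum_add_distrib]
    refine Finset.sum_congr rfl fun j _ => Finset.sum_congr rfl fun k _ => ?_
    have n1 := lam_ne_zero hlam j
    have n2 := conj_lam_ne_zero hlam k
    field_simp
  simp only [originA, originB, map_sub, map_neg, map_one, map_sum, map_div₀, Complex.conj_conj]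
  linear_combination h3 - h4

/-- Differentiated linear system along a curve of norming constants. -/
theorem residues_deriv_system (hlam : ∀ i, 0 < (lam i).im) {c : ℝ → ι → ℂ} {c' : ι → ℂ} {s : ℝ}
    (hc : ∀ i, HasDerivAt (fun x => c x i) (c' i) s) {dA dB : ι → ℂ}
    (hA : ∀ i, HasDerivAt (fun x => resA lam (c x) i) (dA i) s)
    (hB : ∀ i, HasDerivAt (fun x => resB lam (c x) i) (dB i) s) :
    (∀ j, dA j = c s j * ∑ k, dB k / (lam j - conj (lam k)) +
      c' j * ∑ k, resB lam (c s) k / (lam j - conj (lam k))) ∧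
    (∀ j, dB j = -conj (c s j) * ∑ k, dA k / (conj (lam j) - lam k) -
      conj (c' j) * (1 + ∑ k, resA lam (c s) k / (conj (lam j) - lam k))) := by
  constructor
  · intro j
    have h := (hc j).mul (HasDerivAt.fun_sum (u := Finset.univ) fun k _ =>
      (hB k).div_const (lam j - conj (lam k)))
    have h2 := (hA j).congr_of_eventuallyEq
      (Eventually.of_forall fun x => (resA_eq hlam (c x) j).symm)
    rw [h2.unique h, add_comm]
  · intro j
    have hcj : HasDerivAt (fun x => conj (c x j)) (conj (c' j)) s := (hc j).star
    have h := hcj.neg.mul ((HasDerivAt.fun_sum (u := Finset.univ) fun k _ =>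
      (hA k).div_const (conj (lam j) - lam k)).const_add 1)
    have h2 := (hB j).congr_of_eventuallyEq
      (Eventually.of_forall fun x => (resB_eq hlam (c x) j).symm)
    rw [h2.unique h]
    simp only [Pi.neg_apply]
    ring

/-- The `t`-part of the Lax pair, for the residues. -/
theorem residues_deriv_t (hlam : ∀ i, 0 < (lam i).im) {c : ℝ → ι → ℂ} {s : ℝ}
    (hc : ∀ i, HasDerivAt (fun x => c x i) (-2 * Complex.I * lam i * c s i) s) {dA dB : ι → ℂ}
    (hA : ∀ i, HasDerivAt (fun x => resA lam (c x) i) (dA i) s)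
    (hB : ∀ i, HasDerivAt (fun x => resB lam (c x) i) (dB i) s) :
    (∀ j, dA j = -potential lam (c s) * conj (resB lam (c s) j)) ∧
    (∀ j, dB j = 2 * Complex.I * conj (lam j) * resB lam (c s) j +
      potential lam (c s) * conj (resA lam (c s) j)) := by
  obtain ⟨h1, h2⟩ := residues_deriv_system hlam hc hA hB
  set A := resA lam (c s)
  set B := resB lam (c s)
  set q := potential lam (c s) with hq
  -- The actual derivative minus the one predicted by the Lax pair solves the homogeneous system,
  -- hence vanishes.
  obtain ⟨e1, e2⟩ := residue_system_injective hlam (c := c s)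
    (A := fun j => dA j + q * conj (B j))
    (B := fun j => dB j - 2 * Complex.I * conj (lam j) * B j - q * conj (A j))
    (fun j => by
      -- Writing `conj λ_k = λ_j - (λ_j - conj λ_k)` splits off the bare sum of the `B k`, that is,
      -- the potential.
      have e : ∑ k, (dB k - 2 * Complex.I * conj (lam k) * B k - q * conj (A k)) /
          (lam j - conj (lam k)) = ∑ k, dB k / (lam j - conj (lam k)) -
          2 * Complex.I * lam j * ∑ k, B k / (lam j - conj (lam k)) +
          2 * Complex.I * ∑ k, B k - q * ∑ k, conj (A k) / (lam j - conj (lam k)) := by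
        simp only [Finset.mul_sum, ← Finset.sum_sub_distrib, ← Finset.sum_add_distrib]
        refine Finset.sum_congr rfl fun k _ => ?_
        have := sub_conj_ne_zero hlam j k
        field_simp
        ring
      rw [e, h1 j]
      have hB := conj_resB hlam (c s) j
      have hq' : q = -2 * Complex.I * ∑ k, B k := hq
      linear_combination q * hB - c s j * hq')
    (fun j => by
      have e : ∑ k, (dA k + q * conj (B k)) / (conj (lam j) - lam k) =
          ∑ k, dA k / (conj (lam j) - lam k) +
          q * ∑ k, conj (B k) / (conj (lam j) - lam k) := by
        simp only [Finset.mul_sum, ← Finset.sum_add_distrib]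
        exact Finset.sum_congr rfl fun k _ => by ring
      rw [e, h2 j]
      have hA := conj_resA hlam (c s) j
      have hB := resB_eq hlam (c s) j
      simp only [map_mul, map_neg, Complex.conj_I, map_ofNat]
      linear_combination -q * hA - 2 * Complex.I * conj (lam j) * hB)
  refine ⟨fun j => ?_, fun j => ?_⟩
  · have := congrFun e1 j
    simp only [Pi.zero_apply] at this
    linear_combination this
  · have := congrFun e2 j
    simp only [Pi.zero_apply] at this
    linear_combination this

/-- The `z`-part of the Lax pair, for the residues. -/
theorem residues_deriv_z (hlam : ∀ i, 0 < (lam i).im) {δ D P : ℂ} (hδ : conj δ = δ)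
    {c : ℝ → ι → ℂ} {s : ℝ}
    (hc : ∀ i, HasDerivAt (fun x => c x i) (Complex.I * δ / lam i * c s i) s)
    (hD1 : (δ - D) * originA lam (c s) + P * conj (originB lam (c s)) = 0)
    (hD2 : (δ + D) * originB lam (c s) + P * conj (originA lam (c s)) = 0)
    {dA dB : ι → ℂ}
    (hA : ∀ i, HasDerivAt (fun x => resA lam (c x) i) (dA i) s)
    (hB : ∀ i, HasDerivAt (fun x => resB lam (c x) i) (dB i) s) (j : ι) :
    dB j = -(Complex.I / (2 * conj (lam j))) *
      ((δ + D) * resB lam (c s) j + P * conj (resA lam (c s) j)) := by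
  obtain ⟨h1, h2⟩ := residues_deriv_system hlam hc hA hB
  simp only [originA, originB, map_sub, map_neg, map_one, map_sum, map_div₀,
    Complex.conj_conj] at hD1 hD2
  set A := resA lam (c s)
  set B := resB lam (c s)
  -- Same principle as for `t`. The factors `1/λ` give, by partial fractions, extra sums belonging
  -- to the values at the origin. These cancel by `hD1` and `hD2`, which say that the columns of
  -- `M(0)` are eigenvectors of `ρ` for `δ` and `-δ`.
  obtain ⟨-, e2⟩ := residue_system_injective hlam (c := c s)
    (A := fun j => dA j - Complex.I / (2 * lam j) * ((δ - D) * A j + P * conj (B j)))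
    (B := fun j => dB j + Complex.I / (2 * conj (lam j)) * ((δ + D) * B j + P * conj (A j)))
    (fun j => by
      have hl := lam_ne_zero hlam j
      have e : ∑ k, (dB k + Complex.I / (2 * conj (lam k)) *
          ((δ + D) * B k + P * conj (A k))) / (lam j - conj (lam k)) =
          ∑ k, dB k / (lam j - conj (lam k)) + Complex.I / (2 * lam j) *
          ((δ + D) * (∑ k, B k / conj (lam k) + ∑ k, B k / (lam j - conj (lam k))) +
          P * (∑ k, conj (A k) / conj (lam k) + ∑ k, conj (A k) / (lam j - conj (lam k)))) := by
        simp only [Finset.mul_sum, ← Finset.sum_add_distrib]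
        refine Finset.sum_congr rfl fun k _ => ?_
        have n1 := sub_conj_ne_zero hlam j k
        have n2 := conj_lam_ne_zero hlam k
        field_simp
        ring
      rw [e, h1 j]
      have hA := resA_eq hlam (c s) j
      have hB := conj_resB hlam (c s) j
      linear_combination -(Complex.I / (2 * lam j)) * (δ - D) * hA
        - Complex.I / (2 * lam j) * P * hB
        + c s j * (Complex.I / (2 * lam j)) * hD2)
    (fun j => by
      have hl := conj_lam_ne_zero hlam j
      have e : ∑ k, (dA k - Complex.I / (2 * lam k) *
          ((δ - D) * A k + P * conj (B k))) / (conj (lam j) - lam k) =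
          ∑ k, dA k / (conj (lam j) - lam k) - Complex.I / (2 * conj (lam j)) *
          ((δ - D) * (∑ k, A k / lam k + ∑ k, A k / (conj (lam j) - lam k)) +
          P * (∑ k, conj (B k) / lam k + ∑ k, conj (B k) / (conj (lam j) - lam k))) := by
        simp only [Finset.mul_sum, ← Finset.sum_sub_distrib, ← Finset.sum_add_distrib]
        refine Finset.sum_congr rfl fun k _ => ?_
        have n1 := conj_sub_ne_zero hlam j k
        have n2 := lam_ne_zero hlam k
        field_simp
        ring
      rw [e, h2 j]
      have hA := conj_resA hlam (c s) j
      have hB := resB_eq hlam (c s) j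
      simp only [map_mul, map_div₀, Complex.conj_I, hδ]
      linear_combination Complex.I / (2 * conj (lam j)) * (δ + D) * hB
        + Complex.I / (2 * conj (lam j)) * P * hA
        + conj (c s j) * (Complex.I / (2 * conj (lam j))) * hD1)
  have := congrFun e2 j
  simp only [Pi.zero_apply] at this
  linear_combination this

end MBE

/-! ### The soliton triple solves the Maxwell-Bloch equations -/

namespace MBE

variable {ι : Type*} [Fintype ι] [DecidableEq ι] {lam : ι → ℂ}

/-- The evolving norming constants. -/
noncomputable def norming (lam ω : ι → ℂ) (Dm t z : ℝ) (i : ι) : ℂ :=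
  ω i * Complex.exp (-2 * Complex.I * θ Dm t z (lam i))

/-- The soliton triple. -/
noncomputable def solitonFields (lam ω : ι → ℂ) (Dm : ℝ) : Fields where
  q t z := potential lam (norming lam ω Dm t z)
  D t z := Dm * (Complex.normSq (originA lam (norming lam ω Dm t z)) -
    Complex.normSq (originB lam (norming lam ω Dm t z)))
  P t z := -2 * Dm * originA lam (norming lam ω Dm t z) * originB lam (norming lam ω Dm t z)

omit [Fintype ι] [DecidableEq ι] in
theorem contDiff_norming (lam ω : ι → ℂ) (Dm : ℝ) (i : ι) {n : WithTop ℕ∞} :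
    ContDiff ℝ n fun x : ℝ × ℝ => norming lam ω Dm x.1 x.2 i := by
  have h : ∀ f : ℝ × ℝ → ℝ, ContDiff ℝ n f → ContDiff ℝ n fun x => (f x : ℂ) := fun f hf =>
    Complex.ofRealCLM.contDiff.comp hf
  unfold norming θ
  exact contDiff_const.mul (contDiff_const.mul ((contDiff_const.mul (h _ contDiff_fst)).sub
    (contDiff_const.mul (h _ contDiff_snd)))).cexp

omit [Fintype ι] [DecidableEq ι] in
theorem hasDerivAt_norming_t (lam ω : ι → ℂ) (Dm t z : ℝ) (i : ι) :
    HasDerivAt (fun s => norming lam ω Dm s z i)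
      (-2 * Complex.I * lam i * norming lam ω Dm t z i) t := by
  unfold norming θ
  have h := ((((hasDerivAt_id t).ofReal_comp.const_mul (lam i)).sub_const
    ((Dm : ℂ) / (2 * lam i) * z)).const_mul (-2 * Complex.I)).cexp.const_mul (ω i)
  refine h.congr_deriv ?_
  simp; ring

omit [Fintype ι] [DecidableEq ι] in
theorem hasDerivAt_norming_z (lam ω : ι → ℂ) (Dm t z : ℝ) (i : ι) :
    HasDerivAt (fun s => norming lam ω Dm t s i)
      (Complex.I * Dm / lam i * norming lam ω Dm t z i) z := by
  unfold norming θ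
  have h := ((((hasDerivAt_id z).ofReal_comp.const_mul ((Dm : ℂ) / (2 * lam i))).const_sub
    (lam i * t)).const_mul (-2 * Complex.I)).cexp.const_mul (ω i)
  refine h.congr_deriv ?_
  simp; ring

theorem contDiff_resA_norming (hlam : ∀ i, 0 < (lam i).im) (ω : ι → ℂ) (Dm : ℝ) (i : ι)
    {n : WithTop ℕ∞} :
    ContDiff ℝ n fun x : ℝ × ℝ => resA lam (norming lam ω Dm x.1 x.2) i :=
  contDiff_residues hlam (fun i => contDiff_norming lam ω Dm i) _

theorem contDiff_resB_norming (hlam : ∀ i, 0 < (lam i).im) (ω : ι → ℂ) (Dm : ℝ) (i : ι)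
    {n : WithTop ℕ∞} :
    ContDiff ℝ n fun x : ℝ × ℝ => resB lam (norming lam ω Dm x.1 x.2) i :=
  contDiff_residues hlam (fun i => contDiff_norming lam ω Dm i) _

/-- Differentiating the linear system identifies the derivatives only once they are known to exist;
existence comes from joint smoothness. -/
theorem exists_hasDerivAt_slices {f : ℝ × ℝ → ℂ} (hf : ContDiff ℝ 1 f) (t z : ℝ) :
    (∃ d, HasDerivAt (fun s => f (s, z)) d t) ∧ ∃ d, HasDerivAt (fun s => f (t, s)) d z := by
  have h := hf.differentiable one_ne_zero
  constructor
  · exact ⟨_, ((h.comp (g := f) (f := fun s : ℝ => (s, z)) (by fun_prop)) t).hasDerivAt⟩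
  · exact ⟨_, ((h.comp (g := f) (f := fun s : ℝ => (t, s)) (by fun_prop)) z).hasDerivAt⟩

theorem hasDerivAt_resA_t (hlam : ∀ i, 0 < (lam i).im) (ω : ι → ℂ) (Dm t z : ℝ) (j : ι) :
    HasDerivAt (fun s => resA lam (norming lam ω Dm s z) j)
      (-potential lam (norming lam ω Dm t z) * conj (resB lam (norming lam ω Dm t z) j)) t := by
  choose dA hA using fun i =>
    (exists_hasDerivAt_slices (contDiff_resA_norming hlam ω Dm i) t z).1
  choose dB hB using fun i =>
    (exists_hasDerivAt_slices (contDiff_resB_norming hlam ω Dm i) t z).1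
  rw [← (residues_deriv_t hlam (hasDerivAt_norming_t lam ω Dm t z) hA hB).1 j]
  exact hA j

theorem hasDerivAt_resB_t (hlam : ∀ i, 0 < (lam i).im) (ω : ι → ℂ) (Dm t z : ℝ) (j : ι) :
    HasDerivAt (fun s => resB lam (norming lam ω Dm s z) j)
      (2 * Complex.I * conj (lam j) * resB lam (norming lam ω Dm t z) j +
        potential lam (norming lam ω Dm t z) * conj (resA lam (norming lam ω Dm t z) j)) t := by
  choose dA hA using fun i =>
    (exists_hasDerivAt_slices (contDiff_resA_norming hlam ω Dm i) t z).1
  choose dB hB using fun i =>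
    (exists_hasDerivAt_slices (contDiff_resB_norming hlam ω Dm i) t z).1
  rw [← (residues_deriv_t hlam (hasDerivAt_norming_t lam ω Dm t z) hA hB).2 j]
  exact hB j

theorem hasDerivAt_originA_t (hlam : ∀ i, 0 < (lam i).im) (ω : ι → ℂ) (Dm t z : ℝ) :
    HasDerivAt (fun s => originA lam (norming lam ω Dm s z))
      (-potential lam (norming lam ω Dm t z) * conj (originB lam (norming lam ω Dm t z))) t := by
  have h := (HasDerivAt.fun_sum (u := Finset.univ) fun j _ =>
    (hasDerivAt_resA_t hlam ω Dm t z j).div_const (lam j)).const_sub 1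
  refine h.congr_deriv ?_
  simp only [originB, map_neg, map_sum, map_div₀, Complex.conj_conj, neg_mul,
    neg_div, Finset.sum_neg_distrib, neg_neg, Finset.mul_sum, mul_neg]
  exact Finset.sum_congr rfl fun k _ => by ring

/-- In the first term of the derivative of `resB` the factor `conj (lam j)` cancels the denominator,
leaving `2i ∑ B = -q`. This supplies the constant `1` in `conj (originA …)`. -/
theorem hasDerivAt_originB_t (hlam : ∀ i, 0 < (lam i).im) (ω : ι → ℂ) (Dm t z : ℝ) :
    HasDerivAt (fun s => originB lam (norming lam ω Dm s z))
      (potential lam (norming lam ω Dm t z) * conj (originA lam (norming lam ω Dm t z))) t := by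
  have h := (HasDerivAt.fun_sum (u := Finset.univ) fun j _ =>
    (hasDerivAt_resB_t hlam ω Dm t z j).div_const (conj (lam j))).neg
  refine h.congr_deriv ?_
  have e : ∑ j, (2 * Complex.I * conj (lam j) * resB lam (norming lam ω Dm t z) j +
        potential lam (norming lam ω Dm t z) * conj (resA lam (norming lam ω Dm t z) j)) /
        conj (lam j) = 2 * Complex.I * ∑ j, resB lam (norming lam ω Dm t z) j +
        potential lam (norming lam ω Dm t z) *
          ∑ j, conj (resA lam (norming lam ω Dm t z) j) / conj (lam j) := by
    simp only [Finset.mul_sum, ← Finset.sum_add_distrib]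
    refine Finset.sum_congr rfl fun k _ => ?_
    have := conj_lam_ne_zero hlam k
    field_simp
  rw [e]
  have hq : potential lam (norming lam ω Dm t z) =
    -2 * Complex.I * ∑ j, resB lam (norming lam ω Dm t z) j := rfl
  simp only [originA, map_sub, map_one, map_sum, map_div₀]
  linear_combination -hq

theorem solitonFields_D_eq (lam ω : ι → ℂ) (Dm t z : ℝ) :
    ((solitonFields lam ω Dm).D t z : ℂ) =
      Dm * (originA lam (norming lam ω Dm t z) * conj (originA lam (norming lam ω Dm t z)) -
        originB lam (norming lam ω Dm t z) * conj (originB lam (norming lam ω Dm t z))) := by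
  simp [solitonFields, Complex.mul_conj]

/-- With `a`, `b` the first row of `M(0)`, the equations for `P_t` and `D_t` are the product rule
applied to `a_t = -q conj b`, `b_t = q conj a`. The equation for `q_z` comes from summing the
`z`-derivatives of the residues `B`; the eigenvector relations needed there reduce to `|a|² + |b|² =
1`. -/
theorem solitonFields_solvesMBE (hlam : ∀ i, 0 < (lam i).im) (ω : ι → ℂ) (Dm : ℝ) :
    (solitonFields lam ω Dm).SolvesMBE := by
  have ha : ContDiff ℝ 1 fun x : ℝ × ℝ => originA lam (norming lam ω Dm x.1 x.2) :=
    contDiff_const.sub (ContDiff.sum fun i _ => (contDiff_resA_norming hlam ω Dm i).div_const _)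
  have hb : ContDiff ℝ 1 fun x : ℝ × ℝ => originB lam (norming lam ω Dm x.1 x.2) :=
    (ContDiff.sum fun i _ => (contDiff_resB_norming hlam ω Dm i).div_const _).neg
  have hn : ∀ f : ℝ × ℝ → ℂ, ContDiff ℝ 1 f → ContDiff ℝ 1 fun x => Complex.normSq (f x) := by
    intro f hf
    simp only [Complex.normSq_eq_norm_sq]
    exact hf.norm_sq ℝ
  refine ⟨?_, ?_, ?_, fun t z => ?_, fun t z => ?_, fun t z => ?_⟩
  · exact contDiff_const.mul (ContDiff.sum fun i _ => contDiff_resB_norming hlam ω Dm i)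
  · exact contDiff_const.mul ((hn _ ha).sub (hn _ hb))
  · exact (contDiff_const.mul ha).mul hb
  · choose dA hA using fun i =>
      (exists_hasDerivAt_slices (contDiff_resA_norming hlam ω Dm i) t z).2
    choose dB hB using fun i =>
      (exists_hasDerivAt_slices (contDiff_resB_norming hlam ω Dm i) t z).2
    have hu := origin_unitary hlam (norming lam ω Dm t z)
    have hD := solitonFields_D_eq lam ω Dm t z
    have hP : (solitonFields lam ω Dm).P t z =
      -2 * Dm * originA lam (norming lam ω Dm t z) * originB lam (norming lam ω Dm t z) := rfl
    have h1 : ((Dm : ℂ) - (solitonFields lam ω Dm).D t z) * originA lam (norming lam ω Dm t z) +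
        (solitonFields lam ω Dm).P t z * conj (originB lam (norming lam ω Dm t z)) = 0 := by
      rw [hD, hP]
      linear_combination -Dm * originA lam (norming lam ω Dm t z) * hu
    have h2 : ((Dm : ℂ) + (solitonFields lam ω Dm).D t z) * originB lam (norming lam ω Dm t z) +
        (solitonFields lam ω Dm).P t z * conj (originA lam (norming lam ω Dm t z)) = 0 := by
      rw [hD, hP]
      linear_combination -Dm * originB lam (norming lam ω Dm t z) * hu
    have hd := residues_deriv_z hlam (Complex.conj_ofReal Dm)
      (hasDerivAt_norming_z lam ω Dm t z) h1 h2 hA hB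
    have h := (HasDerivAt.fun_sum (u := Finset.univ) fun j _ => hB j).const_mul (-2 * Complex.I)
    refine h.congr_deriv ?_
    set D := ((solitonFields lam ω Dm).D t z : ℂ)
    set P := (solitonFields lam ω Dm).P t z
    have e : ∑ j, dB j = -(Complex.I / 2) *
        ((Dm + D) * ∑ j, resB lam (norming lam ω Dm t z) j / conj (lam j) +
        P * ∑ j, conj (resA lam (norming lam ω Dm t z) j) / conj (lam j)) := by
      simp only [Finset.mul_sum, ← Finset.sum_add_distrib]
      refine Finset.sum_congr rfl fun k _ => ?_
      rw [hd k]
      have := conj_lam_ne_zero hlam k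
      field_simp
    rw [e]
    -- The second eigenvector relation says that the bracket in `e` equals `P`.
    simp only [originA, originB, map_sub, map_one, map_sum, map_div₀] at h2
    linear_combination h2 + ((Dm + D) * ∑ j, resB lam (norming lam ω Dm t z) j / conj (lam j) +
        P * ∑ j, conj (resA lam (norming lam ω Dm t z) j) / conj (lam j)) * Complex.I_sq
  · have h := ((hasDerivAt_originA_t hlam ω Dm t z).const_mul (-2 * Dm : ℂ)).mul
      (hasDerivAt_originB_t hlam ω Dm t z)
    refine h.congr_deriv ?_
    rw [solitonFields_D_eq]
    simp only [solitonFields]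
    ring
  · have hA := hasDerivAt_originA_t hlam ω Dm t z
    have hB := hasDerivAt_originB_t hlam ω Dm t z
    have h := ((hA.mul hA.star).sub (hB.mul hB.star)).const_mul (Dm : ℂ)
    have h2 := Complex.reCLM.hasFDerivAt.comp_hasDerivAt t h
    refine (h2.congr_deriv ?_).congr_of_eventuallyEq (Eventually.of_forall fun s => ?_)
    · simp only [solitonFields, Complex.reCLM_apply]
      simp
      ring
    · have e := congrArg Complex.re (solitonFields_D_eq lam ω Dm s z)
      rwa [Complex.ofReal_re] at e

/-- `|exp(-2iλt)| = exp(2t Im λ)` tends to `0` as `t → -∞`, and the residues are continuous in the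
norming constants and vanish when these do. -/
theorem solitonFields_hasBoundaryValues (hlam : ∀ i, 0 < (lam i).im) (ω : ι → ℂ) (Dm : ℝ) :
    (solitonFields lam ω Dm).HasBoundaryValues Dm := by
  have hc : ∀ z i, Tendsto (fun t => norming lam ω Dm t z i) atBot (𝓝 0) := by
    intro z i
    have : ∀ t, norming lam ω Dm t z i =
        (ω i * Complex.exp (Complex.I * (Dm / lam i * z))) *
          Complex.exp (-2 * Complex.I * lam i * t) := by
      intro t
      unfold norming θ
      rw [mul_assoc (ω i), ← Complex.exp_add]
      congr 2
      have := lam_ne_zero hlam i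
      field_simp
      ring
    simp only [this]
    rw [← mul_zero (ω i * Complex.exp (Complex.I * (Dm / lam i * z)))]
    refine tendsto_const_nhds.mul ?_
    rw [tendsto_zero_iff_norm_tendsto_zero]
    simp only [Complex.norm_exp]
    refine Real.tendsto_exp_atBot.comp ?_
    have : ∀ t : ℝ, (-2 * Complex.I * lam i * t).re = 2 * (lam i).im * t := fun t => by simp
    simp only [this]
    exact tendsto_id.const_mul_atBot (by linarith [hlam i])
  have hres : ∀ z x, Tendsto (fun t => residues lam (norming lam ω Dm t z) x) atBot (𝓝 0) := by
    intro z x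
    have h1 : Tendsto (fun t => norming lam ω Dm t z) atBot (𝓝 0) := tendsto_pi_nhds.2 (hc z)
    have h2 : Continuous fun c : ι → ℂ => residues lam c x :=
      (contDiff_residues (n := 0) hlam (c := id) (fun i => contDiff_apply ℝ ℂ i) x).continuous
    have := (h2.tendsto 0).comp h1
    rwa [residues_zero] at this
  have ha : ∀ z, Tendsto (fun t => originA lam (norming lam ω Dm t z)) atBot (𝓝 1) := by
    intro z
    have := tendsto_const_nhds (x := (1 : ℂ)).sub (tendsto_finsetSum Finset.univ fun j _ =>
      (hres z (Sum.inl j)).div_const (lam j))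
    simpa [originA, resA] using this
  have hb : ∀ z, Tendsto (fun t => originB lam (norming lam ω Dm t z)) atBot (𝓝 0) := by
    intro z
    have := (tendsto_finsetSum Finset.univ fun j _ =>
      (hres z (Sum.inr j)).div_const (conj (lam j))).neg
    simpa [originB, resB] using this
  refine ⟨fun z => ?_, fun z => ?_, fun z => ?_⟩
  · have := (tendsto_finsetSum Finset.univ fun j _ =>
      hres z (Sum.inr j)).const_mul (-2 * Complex.I)
    simpa [solitonFields, potential, resB] using this
  · have := ((ha z).const_mul (-2 * Dm : ℂ)).mul (hb z)
    simpa [solitonFields] using this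
  · have := (((Complex.continuous_normSq.tendsto _).comp (ha z)).sub
      ((Complex.continuous_normSq.tendsto _).comp (hb z))).const_mul Dm
    simpa [solitonFields] using this

end MBE

/-! ### Pole sums and the explicit solution of the residue conditions -/

namespace MBE

/-- The rational function with simple poles at `w i` and residues `X i`, vanishing at infinity. -/
noncomputable def poleSum {ι : Type*} [Fintype ι] (w X : ι → ℂ) (l : ℂ) : ℂ := ∑ i, X i / (l - w i)

section poleSum

variable {ι : Type*} [Fintype ι] {w : ι → ℂ} (X : ι → ℂ)

theorem differentiableAt_poleSum {l : ℂ} (hl : l ∉ range w) :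
    DifferentiableAt ℂ (poleSum w X) l := by
  have : ∀ i, l - w i ≠ 0 := fun i h => hl ⟨i, (sub_eq_zero.1 h).symm⟩
  exact DifferentiableAt.fun_sum fun i _ =>
    (differentiableAt_const _).div (differentiableAt_id.sub_const _) (this i)

theorem tendsto_poleSum {l : ℂ} (hl : l ∉ range w) :
    Tendsto (poleSum w X) (𝓝[≠] l) (𝓝 (poleSum w X l)) :=
  (differentiableAt_poleSum X hl).continuousAt.tendsto.mono_left nhdsWithin_le_nhds

theorem tendsto_sub_self_nhdsNE (p : ℂ) : Tendsto (fun l => l - p) (𝓝[≠] p) (𝓝 0) := by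
  have : Tendsto (fun l => l - p) (𝓝 p) (𝓝 (p - p)) := Continuous.tendsto (by fun_prop) p
  rw [sub_self] at this
  exact this.mono_left nhdsWithin_le_nhds

theorem tendsto_sub_mul_zero {f : ℂ → ℂ} {p a : ℂ} (hf : Tendsto f (𝓝[≠] p) (𝓝 a)) :
    Tendsto (fun l => (l - p) * f l) (𝓝[≠] p) (𝓝 0) := by
  simpa using (tendsto_sub_self_nhdsNE p).mul hf

theorem tendsto_sub_mul_poleSum (hw : Function.Injective w) (i : ι) :
    Tendsto (fun l => (l - w i) * poleSum w X l) (𝓝[≠] (w i)) (𝓝 (X i)) := by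
  classical
  have h : ∀ j, Tendsto (fun l => (l - w i) * (X j / (l - w j))) (𝓝[≠] (w i))
      (𝓝 (if j = i then X i else 0)) := by
    intro j
    split_ifs with hj
    · subst hj
      refine tendsto_const_nhds.congr' ?_
      filter_upwards [self_mem_nhdsWithin] with l hl
      have : l - w j ≠ 0 := sub_ne_zero.2 hl
      field_simp
    · refine tendsto_sub_mul_zero (a := X j / (w i - w j)) ?_
      have : w i - w j ≠ 0 := sub_ne_zero.2 fun h => hj (hw h).symm
      have hc : ContinuousAt (fun l => X j / (l - w j)) (w i) :=
        continuousAt_const.div (continuousAt_id.sub continuousAt_const) this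
      exact hc.tendsto.mono_left nhdsWithin_le_nhds
  have := tendsto_finsetSum Finset.univ fun j _ => h j
  simpa [poleSum, Finset.mul_sum] using this

theorem tendsto_sub_cobounded (a : ℂ) :
    Tendsto (fun l : ℂ => l - a) (Bornology.cobounded ℂ) (Bornology.cobounded ℂ) := by
  simp [sub_eq_add_neg]

theorem tendsto_poleSum_cobounded :
    Tendsto (poleSum w X) (Bornology.cobounded ℂ) (𝓝 0) := by
  have := tendsto_finsetSum Finset.univ fun i (_ : i ∈ Finset.univ) =>
    ((tendsto_inv₀_cobounded (α := ℂ)).comp (tendsto_sub_cobounded (w i))).const_mul (X i)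
  simpa [poleSum, div_eq_mul_inv] using! this

theorem tendsto_mul_poleSum_cobounded :
    Tendsto (fun l => l * poleSum w X l) (Bornology.cobounded ℂ) (𝓝 (∑ i, X i)) := by
  have h : ∀ i, Tendsto (fun l => l * (X i / (l - w i))) (Bornology.cobounded ℂ) (𝓝 (X i)) := by
    intro i
    have h1 := (((tendsto_inv₀_cobounded (α := ℂ)).comp (tendsto_sub_cobounded (w i))).const_mul
      (X i * w i)).const_add (X i)
    rw [mul_zero, add_zero] at h1
    refine h1.congr' ?_
    filter_upwards [(finite_singleton (w i)).eventually_cobounded_notMem] with l hl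
    have : l - w i ≠ 0 := sub_ne_zero.2 hl
    simp only [Function.comp]
    field_simp
    ring
  have := tendsto_finsetSum Finset.univ fun i (_ : i ∈ Finset.univ) => h i
  simpa [poleSum, Finset.mul_sum] using this

end poleSum

variable {ι : Type*} [Fintype ι] {lam : ι → ℂ}

/-- The points of a family together with their conjugates. -/
def conjPoints (lam : ι → ℂ) : Set ℂ := range lam ∪ range fun i => conj (lam i)

theorem conjPoints_finite (lam : ι → ℂ) : (conjPoints lam).Finite :=
  (finite_range _).union (finite_range _)

omit [Fintype ι] in
theorem lam_notMem_range_conj (hlam : ∀ i, 0 < (lam i).im) (i : ι) :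
    lam i ∉ range fun i => conj (lam i) := fun ⟨j, hj⟩ =>
  sub_conj_ne_zero hlam i j (sub_eq_zero.2 hj.symm)

omit [Fintype ι] in
theorem conj_lam_notMem_range (hlam : ∀ i, 0 < (lam i).im) (i : ι) :
    conj (lam i) ∉ range lam := fun ⟨j, hj⟩ =>
  conj_sub_ne_zero hlam i j (sub_eq_zero.2 hj.symm)

theorem eventually_nhdsNE_notMem_of_finite {s : Set ℂ} (hs : s.Finite) (p : ℂ) :
    ∀ᶠ l in 𝓝[≠] p, l ∉ s := by
  have h : (s \ {p})ᶜ ∈ 𝓝 p := (hs.subset sdiff_subset).isClosed.isOpen_compl.mem_nhds (by simp)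
  filter_upwards [mem_nhdsWithin_of_mem_nhds h, self_mem_nhdsWithin] with l h1 h2 h3
  exact h1 ⟨h3, h2⟩

/-- Subtracting the pole sum with the same residues leaves removable singularities and limit `0` at
infinity. -/
theorem eq_poleSum_of_residues (hinj : Function.Injective lam)
    (hlam : ∀ i, 0 < (lam i).im) {f : ℂ → ℂ} {r : ι → ℂ}
    (hf : DifferentiableOn ℂ f (conjPoints lam)ᶜ)
    (hf0 : Tendsto f (Bornology.cobounded ℂ) (𝓝 0))
    (h1 : ∀ i, Tendsto (fun l => (l - lam i) * f l) (𝓝[≠] (lam i)) (𝓝 (r i)))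
    (h2 : ∀ i, Tendsto (fun l => (l - conj (lam i)) * f l) (𝓝[≠] (conj (lam i))) (𝓝 0))
    {l : ℂ} (hl : l ∉ conjPoints lam) : f l = poleSum lam r l := by
  rw [← sub_eq_zero]
  refine eq_zero_of_removable_of_tendsto_zero (conjPoints_finite lam)
    (f := fun l => f l - poleSum lam r l) (fun x hx => ?_) ?_ ?_ hl
  · exact (hf x hx).sub (differentiableAt_poleSum r fun h => hx (Or.inl h)).differentiableWithinAt
  · rintro _ (⟨i, rfl⟩ | ⟨i, rfl⟩)
    · simpa [mul_sub] using (h1 i).sub (tendsto_sub_mul_poleSum r hinj i)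
    · simpa [mul_sub] using (h2 i).sub (tendsto_sub_mul_zero
        (tendsto_poleSum r (conj_lam_notMem_range hlam i)))
  · simpa using hf0.sub (tendsto_poleSum_cobounded r)

theorem eq_poleSum_conj_of_residues (hinj : Function.Injective lam)
    (hlam : ∀ i, 0 < (lam i).im) {f : ℂ → ℂ} {r : ι → ℂ}
    (hf : DifferentiableOn ℂ f (conjPoints lam)ᶜ)
    (hf0 : Tendsto f (Bornology.cobounded ℂ) (𝓝 0))
    (h1 : ∀ i, Tendsto (fun l => (l - lam i) * f l) (𝓝[≠] (lam i)) (𝓝 0))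
    (h2 : ∀ i, Tendsto (fun l => (l - conj (lam i)) * f l) (𝓝[≠] (conj (lam i))) (𝓝 (r i)))
    {l : ℂ} (hl : l ∉ conjPoints lam) : f l = poleSum (fun i => conj (lam i)) r l := by
  have hinj' : Function.Injective fun i => conj (lam i) :=
    (starRingEnd ℂ).injective.comp hinj
  rw [← sub_eq_zero]
  refine eq_zero_of_removable_of_tendsto_zero (conjPoints_finite lam)
    (f := fun l => f l - poleSum (fun i => conj (lam i)) r l) (fun x hx => ?_) ?_ ?_ hl
  · exact (hf x hx).sub (differentiableAt_poleSum r fun h => hx (Or.inr h)).differentiableWithinAt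
  · rintro _ (⟨i, rfl⟩ | ⟨i, rfl⟩)
    · simpa [mul_sub] using (h1 i).sub (tendsto_sub_mul_zero
        (tendsto_poleSum r (lam_notMem_range_conj hlam i)))
    · simpa [mul_sub] using (h2 i).sub (tendsto_sub_mul_poleSum r hinj' i)
  · simpa using hf0.sub (tendsto_poleSum_cobounded r)

/-- A row vector satisfying the residue conditions and vanishing at infinity is zero. -/
theorem row_eq_zero_of_residues (hinj : Function.Injective lam)
    (hlam : ∀ i, 0 < (lam i).im) {c : ι → ℂ} {f g : ℂ → ℂ} {h k : ι → ℂ → ℂ}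
    (hh : ∀ i, Tendsto (h i) (𝓝[≠] (lam i)) (𝓝 (c i)))
    (hk : ∀ i, Tendsto (k i) (𝓝[≠] (conj (lam i))) (𝓝 (-conj (c i))))
    (hf : DifferentiableOn ℂ f (conjPoints lam)ᶜ)
    (hg : DifferentiableOn ℂ g (conjPoints lam)ᶜ)
    (hf0 : Tendsto f (Bornology.cobounded ℂ) (𝓝 0))
    (hg0 : Tendsto g (Bornology.cobounded ℂ) (𝓝 0))
    (hup : ∀ i, ∃ r, Tendsto (fun l => (l - lam i) * f l) (𝓝[≠] (lam i)) (𝓝 r) ∧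
      Tendsto (fun l => (l - lam i) * g l) (𝓝[≠] (lam i)) (𝓝 0) ∧
      Tendsto (fun l => g l * h i l) (𝓝[≠] (lam i)) (𝓝 r))
    (hlow : ∀ i, ∃ r, Tendsto (fun l => (l - conj (lam i)) * f l) (𝓝[≠] (conj (lam i))) (𝓝 0) ∧
      Tendsto (fun l => (l - conj (lam i)) * g l) (𝓝[≠] (conj (lam i))) (𝓝 r) ∧
      Tendsto (fun l => f l * k i l) (𝓝[≠] (conj (lam i))) (𝓝 r)) :
    ∀ l ∉ conjPoints lam, f l = 0 ∧ g l = 0 := by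
  choose r h1 h2 h3 using hup
  choose r' h4 h5 h6 using hlow
  have ef : ∀ l ∉ conjPoints lam, f l = poleSum lam r l := fun l hl =>
    eq_poleSum_of_residues hinj hlam hf hf0 h1 h4 hl
  have eg : ∀ l ∉ conjPoints lam, g l = poleSum (fun i => conj (lam i)) r' l := fun l hl =>
    eq_poleSum_conj_of_residues hinj hlam hg hg0 h2 h5 hl
  -- `g` is regular at `lam i`, so the multiplier `h i` enters only through its limit `c i`, and the
  -- residue conditions become the homogeneous linear system.
  have hr : ∀ i, r i = c i * poleSum (fun i => conj (lam i)) r' (lam i) := fun i => by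
    rw [mul_comm]
    refine tendsto_nhds_unique (h3 i) (((tendsto_poleSum r'
      (lam_notMem_range_conj hlam i)).mul (hh i)).congr' ?_)
    filter_upwards [eventually_nhdsNE_notMem_of_finite (conjPoints_finite lam) (lam i)] with l hl
    rw [eg l hl]
  have hr' : ∀ i, r' i = -conj (c i) * poleSum lam r (conj (lam i)) := fun i => by
    rw [mul_comm]
    refine tendsto_nhds_unique (h6 i) (((tendsto_poleSum r
      (conj_lam_notMem_range hlam i)).mul (hk i)).congr' ?_)
    filter_upwards [eventually_nhdsNE_notMem_of_finite (conjPoints_finite lam)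
      (conj (lam i))] with l hl
    rw [ef l hl]
  obtain ⟨rfl, rfl⟩ := residue_system_injective hlam hr hr'
  exact fun l hl => ⟨by simp [ef l hl, poleSum], by simp [eg l hl, poleSum]⟩

theorem tendsto_mat_iff {α : Type*} {F : Filter α} {M : α → Mat} {N : Mat} :
    Tendsto M F (𝓝 N) ↔ ∀ a b, Tendsto (fun x => M x a b) F (𝓝 (N a b)) := by
  refine Iff.trans (tendsto_pi_nhds (f := fun x a => M x a) (g := fun a => N a)) ?_
  exact forall_congr' fun a => tendsto_pi_nhds

theorem tendsto_mat_of_entries {α : Type*} {F : Filter α} {M : α → Mat} {N : Mat}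
    (h00 : Tendsto (fun x => M x 0 0) F (𝓝 (N 0 0)))
    (h01 : Tendsto (fun x => M x 0 1) F (𝓝 (N 0 1)))
    (h10 : Tendsto (fun x => M x 1 0) F (𝓝 (N 1 0)))
    (h11 : Tendsto (fun x => M x 1 1) F (𝓝 (N 1 1))) : Tendsto M F (𝓝 N) := by
  rw [tendsto_mat_iff]
  intro a b
  fin_cases a <;> fin_cases b
  exacts [h00, h01, h10, h11]

variable [DecidableEq ι]

/-- The soliton solution of the residue-form Riemann-Hilbert problem. -/
noncomputable def solitonMatrix (lam c : ι → ℂ) (l : ℂ) : Mat :=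
  !![1 + poleSum lam (resA lam c) l, poleSum (fun i => conj (lam i)) (resB lam c) l;
    -poleSum lam (fun i => conj (resB lam c i)) l,
    1 + poleSum (fun i => conj (lam i)) (fun i => conj (resA lam c i)) l]

theorem solitonMatrix_differentiableAt (c : ι → ℂ) {l : ℂ} (hl : l ∉ conjPoints lam) (a b : Fin 2) :
    DifferentiableAt ℂ (fun l => solitonMatrix lam c l a b) l := by
  have h1 : l ∉ range lam := fun h => hl (Or.inl h)
  have h2 : l ∉ range fun i => conj (lam i) := fun h => hl (Or.inr h)
  fin_cases a <;> fin_cases b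
  · exact (differentiableAt_poleSum _ h1).const_add 1
  · exact differentiableAt_poleSum _ h2
  · exact (differentiableAt_poleSum _ h1).neg
  · exact (differentiableAt_poleSum _ h2).const_add 1

theorem solitonMatrix_meromorphic (lam c : ι → ℂ) (a b : Fin 2) :
    Meromorphic fun l => solitonMatrix lam c l a b := by
  have h : ∀ w X : ι → ℂ, Meromorphic (poleSum w X) := fun w X x => by
    unfold poleSum
    fun_prop
  intro x
  fin_cases a <;> fin_cases b
  · exact (MeromorphicAt.const 1 x).add (h _ _ x)
  · exact h _ _ x
  · exact (h _ _ x).neg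
  · exact (MeromorphicAt.const 1 x).add (h _ _ x)

theorem solitonMatrix_normalized (lam c : ι → ℂ) : NormalizedAtInfinity (solitonMatrix lam c) := by
  refine tendsto_mat_of_entries ?_ ?_ ?_ ?_
  · simpa [solitonMatrix] using (tendsto_poleSum_cobounded (w := lam) (resA lam c)).const_add 1
  · simpa [solitonMatrix] using! tendsto_poleSum_cobounded (w := fun i => conj (lam i)) (resB lam c)
  · simpa [solitonMatrix] using
      (tendsto_poleSum_cobounded (w := lam) (fun i => conj (resB lam c i))).neg
  · simpa [solitonMatrix] using (tendsto_poleSum_cobounded (w := fun i => conj (lam i))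
      (fun i => conj (resA lam c i))).const_add 1

/-- The second column is regular at `lam i`. The first row of the condition is `resA_eq` and the
second is the conjugate of `resB_eq`, so one linear system serves both rows. -/
theorem solitonMatrix_residue_upper (hinj : Function.Injective lam) (hlam : ∀ i, 0 < (lam i).im)
    (c : ι → ℂ) (i : ι) {h : ℂ → ℂ} (hh : Tendsto h (𝓝[≠] (lam i)) (𝓝 (c i))) :
    ∃ R : Mat, HasSimplePoleResidue (solitonMatrix lam c) (lam i) R ∧
      Tendsto (fun l => solitonMatrix lam c l * !![0, 0; h l, 0]) (𝓝[≠] (lam i)) (𝓝 R) := by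
  have n := lam_notMem_range_conj hlam i
  have tB := tendsto_poleSum (resB lam c) n
  have tA := (tendsto_poleSum (fun i => conj (resA lam c i)) n).const_add 1
  have r1 := (tendsto_sub_mul_zero (tendsto_const_nhds (x := (1 : ℂ)))).add
    (tendsto_sub_mul_poleSum (resA lam c) hinj i)
  have r2 := (tendsto_sub_mul_poleSum (fun i => conj (resB lam c i)) hinj i).neg
  refine ⟨!![resA lam c i, 0; -conj (resB lam c i), 0],
    tendsto_mat_of_entries ?_ ?_ ?_ ?_, tendsto_mat_of_entries ?_ ?_ ?_ ?_⟩
  · simpa [solitonMatrix, mul_add] using r1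
  · simpa [solitonMatrix] using tendsto_sub_mul_zero tB
  · simpa [solitonMatrix] using r2
  · simpa [solitonMatrix] using tendsto_sub_mul_zero tA
  · rw [resA_eq hlam, mul_comm]
    simpa [solitonMatrix, Matrix.mul_apply] using! tB.mul hh
  · simp [Matrix.mul_apply]
  · rw [conj_resB hlam, neg_mul, neg_neg, mul_comm]
    simpa [solitonMatrix, Matrix.mul_apply] using! tA.mul hh
  · simp [Matrix.mul_apply]

theorem solitonMatrix_residue_lower (hinj : Function.Injective lam) (hlam : ∀ i, 0 < (lam i).im)
    (c : ι → ℂ) (i : ι) {k : ℂ → ℂ}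
    (hk : Tendsto k (𝓝[≠] (conj (lam i))) (𝓝 (-conj (c i)))) :
    ∃ R : Mat, HasSimplePoleResidue (solitonMatrix lam c) (conj (lam i)) R ∧
      Tendsto (fun l => solitonMatrix lam c l * !![0, k l; 0, 0])
        (𝓝[≠] (conj (lam i))) (𝓝 R) := by
  have hinj' : Function.Injective fun i => conj (lam i) :=
    (starRingEnd ℂ).injective.comp hinj
  have n := conj_lam_notMem_range hlam i
  have tB := (tendsto_poleSum (fun i => conj (resB lam c i)) n).neg
  have tA := (tendsto_poleSum (resA lam c) n).const_add 1
  have r1 := (tendsto_sub_mul_zero (tendsto_const_nhds (x := (1 : ℂ)))).add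
    (tendsto_sub_mul_poleSum (fun i => conj (resA lam c i)) hinj' i)
  have r2 := tendsto_sub_mul_poleSum (resB lam c) hinj' i
  refine ⟨!![0, resB lam c i; 0, conj (resA lam c i)],
    tendsto_mat_of_entries ?_ ?_ ?_ ?_, tendsto_mat_of_entries ?_ ?_ ?_ ?_⟩
  · simpa [solitonMatrix] using tendsto_sub_mul_zero tA
  · simpa [solitonMatrix] using r2
  · simpa [solitonMatrix] using tendsto_sub_mul_zero tB
  · simpa [solitonMatrix, mul_add] using r1
  · simp [Matrix.mul_apply]
  · rw [resB_eq hlam, mul_comm]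
    simpa [solitonMatrix, Matrix.mul_apply] using! tA.mul hk
  · simp [Matrix.mul_apply]
  · have e : conj (resA lam c i) = -poleSum lam (fun i => conj (resB lam c i)) (conj (lam i)) *
        -conj (c i) := by
      rw [conj_resA hlam, neg_mul_neg, mul_comm]; rfl
    rw [e]
    simpa [solitonMatrix, Matrix.mul_apply] using! tB.mul hk

theorem solitonMatrix_zero (lam c : ι → ℂ) :
    solitonMatrix lam c 0 = !![originA lam c, originB lam c;
      -conj (originB lam c), conj (originA lam c)] := by
  simp [solitonMatrix, poleSum, originA, originB, div_neg, sub_eq_add_neg]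

/-- The commutator with `σ₃` kills the diagonal and doubles the off-diagonal entries up to sign; `l`
times a pole sum tends to the sum of its residues. -/
theorem solitonMatrix_commutator_tendsto (lam c : ι → ℂ) :
    Tendsto (fun l : ℂ => (Complex.I * l) •
      (solitonMatrix lam c l * σ₃ - σ₃ * solitonMatrix lam c l)) (Bornology.cobounded ℂ)
      (𝓝 !![0, potential lam c; -conj (potential lam c), 0]) := by
  have hB := (tendsto_mul_poleSum_cobounded (w := fun i => conj (lam i)) (resB lam c)).const_mul
    (-2 * Complex.I)
  have hC := (tendsto_mul_poleSum_cobounded (w := lam) (fun i => conj (resB lam c i))).const_mul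
    (-2 * Complex.I)
  refine tendsto_mat_of_entries ?_ ?_ ?_ ?_
  · simp [σ₃, solitonMatrix]
  · refine hB.congr fun l => ?_
    simp [σ₃, solitonMatrix]
    ring
  · have e : -conj (potential lam c) = -2 * Complex.I * ∑ i, conj (resB lam c i) := by
      simp only [potential, map_mul, map_neg, map_ofNat, Complex.conj_I, map_sum]
      ring
    simp only [Matrix.of_apply, Matrix.cons_val_zero, Matrix.cons_val_one, Matrix.cons_val', e]
    refine hC.congr fun l => ?_
    simp [σ₃, solitonMatrix]
    ring
  · simp [σ₃, solitonMatrix]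

end MBE

/-! ### The spectral data as one family of poles -/

namespace MBE.SpectralData

variable (S : SpectralData)

/-- The index set of the eigenvalues. -/
abbrev Idx : Type := Σ j : Fin S.J, Fin (S.N j)

/-- The eigenvalues, as a single family. -/
noncomputable def lam (i : S.Idx) : ℂ := S.ev i.1 i.2

/-- The norming constants, as a single family. -/
def normingConst (i : S.Idx) : ℂ := S.ω i.1 i.2

theorem lam_im_pos (i : S.Idx) : 0 < (S.lam i).im := by
  have h : (S.lam i).im = S.r i.1 * Real.sin (S.α i.1 i.2) := by
    simp [lam, ev, mul_comm Complex.I, Complex.exp_ofReal_mul_I_im]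
  rw [h]
  exact mul_pos (S.r_pos _) (Real.sin_pos_of_pos_of_lt_pi (S.α_pos _ _) (S.α_lt_pi _ _))

/-- The modulus determines the group, and cosine is injective on `[0, π]`. -/
theorem lam_injective : Function.Injective S.lam := by
  rintro ⟨j, k⟩ ⟨j', k'⟩ h
  simp only [lam, ev, mul_comm Complex.I] at h
  have hr : S.r j = S.r j' := by
    have := congrArg norm h
    simpa [Complex.norm_exp_ofReal_mul_I, abs_of_pos (S.r_pos _)] using this
  obtain rfl := S.r_strictMono.injective hr
  have hne : (S.r j : ℂ) ≠ 0 := Complex.ofReal_ne_zero.2 (S.r_pos j).ne'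
  have hc := congrArg Complex.re (mul_left_cancel₀ hne h)
  rw [Complex.exp_ofReal_mul_I_re, Complex.exp_ofReal_mul_I_re] at hc
  have := Real.injOn_cos ⟨(S.α_pos j k).le, (S.α_lt_pi j k).le⟩
    ⟨(S.α_pos j k').le, (S.α_lt_pi j k').le⟩ hc
  rw [(S.α_strictMono j).injective this]

theorem poles_eq : S.poles = conjPoints S.lam := by
  ext l
  simp only [poles, Λ, conjPoints, mem_ofPred_eq, mem_union, mem_range, lam, Sigma.exists]
  refine or_congr ?_ ?_
  · simp only [eq_comm]
  · exact exists_congr fun j => exists_congr fun k =>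
      ⟨fun h => by rw [← h, Complex.conj_conj], fun h => by rw [← h, Complex.conj_conj]⟩

theorem poles_finite : S.poles.Finite := S.poles_eq ▸ conjPoints_finite _

/-- The poles, indexed by two copies of the index set. -/
noncomputable def pole : S.Idx ⊕ S.Idx → ℂ := Sum.elim S.lam fun i => conj (S.lam i)

theorem range_pole : range S.pole = S.poles := by
  rw [poles_eq, pole, Sum.elim_range, conjPoints]

theorem pole_mem (p : S.Idx ⊕ S.Idx) : S.pole p ∈ S.poles := S.range_pole ▸ mem_range_self p

theorem pole_injective : Function.Injective S.pole :=
  S.lam_injective.sumElim ((starRingEnd ℂ).injective.comp S.lam_injective)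
    fun i j h => lam_notMem_range_conj S.lam_im_pos i ⟨j, h.symm⟩

theorem im_ne_zero_of_mem_poles {p : ℂ} (hp : p ∈ S.poles) : p.im ≠ 0 := by
  rw [poles_eq] at hp
  rcases hp with ⟨i, rfl⟩ | ⟨i, rfl⟩
  · exact (S.lam_im_pos i).ne'
  · simpa using (S.lam_im_pos i).ne'

theorem zero_notMem_poles : (0 : ℂ) ∉ S.poles := fun h => S.im_ne_zero_of_mem_poles h rfl

theorem pole_ne_zero (p : S.Idx ⊕ S.Idx) : S.pole p ≠ 0 := fun h =>
  S.zero_notMem_poles (h ▸ S.pole_mem p)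

/-! ### Admissible radii -/

theorem admissible_iff {ε : ℝ} : S.Admissible ε ↔ 0 < ε ∧
    (∀ p ∈ S.poles, ∀ q ∈ S.poles, p ≠ q → ε + ε < dist p q) ∧ ∀ p ∈ S.poles, ε < |p.im| := by
  refine and_congr_right fun hε => and_congr ?_ (forall₂_congr fun p hp => ?_)
  · exact forall₂_congr fun p hp => forall₂_congr fun q hq => forall_congr' fun hpq =>
      disjoint_closedBall_closedBall_iff hε.le hε.le
  · constructor
    -- The nearest real point to `p` is `p.re`, at distance `|p.im|`.
    · intro h
      have := h p.re
      rw [Metric.mem_closedBall, not_le, Complex.dist_of_re_eq (by simp)] at this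
      simpa [Real.dist_eq] using this
    · intro h x hx
      rw [Metric.mem_closedBall, Complex.dist_eq] at hx
      have := (Complex.abs_im_le_norm _).trans hx
      simp at this
      linarith

/-- Finitely many strict inequalities persist slightly above `ε`. The case `ε = 0` gives existence
of admissible radii; an admissible `ε` can be enlarged, leaving room around the closed disks. -/
theorem exists_admissible_gt {ε : ℝ} (h0 : 0 ≤ ε)
    (h1 : ∀ p ∈ S.poles, ∀ q ∈ S.poles, p ≠ q → ε + ε < dist p q)
    (h2 : ∀ p ∈ S.poles, ε < |p.im|) : ∃ δ, ε < δ ∧ S.Admissible δ := by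
  have e1 : ∀ᶠ δ in 𝓝[>] ε, ∀ p ∈ S.poles, ∀ q ∈ S.poles, p ≠ q → δ + δ < dist p q := by
    refine (eventually_all_finite S.poles_finite).2 fun p hp =>
      (eventually_all_finite S.poles_finite).2 fun q hq => ?_
    by_cases hpq : p = q
    · exact Eventually.of_forall fun _ h => absurd hpq h
    · have : Tendsto (fun δ : ℝ => δ + δ) (𝓝[>] ε) (𝓝 (ε + ε)) :=
        (Continuous.tendsto (by fun_prop) ε).mono_left nhdsWithin_le_nhds
      filter_upwards [this.eventually_lt_const (h1 p hp q hq hpq)] with δ hδ _ using hδ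
  have e2 : ∀ᶠ δ in 𝓝[>] ε, ∀ p ∈ S.poles, δ < |p.im| :=
    (eventually_all_finite S.poles_finite).2 fun p hp =>
      mem_nhdsWithin_of_mem_nhds (Iio_mem_nhds (h2 p hp))
  obtain ⟨δ, h3, h4, h5⟩ := (e1.and (e2.and self_mem_nhdsWithin)).exists
  exact ⟨δ, h5, S.admissible_iff.2 ⟨h0.trans_lt h5, h3, h4⟩⟩

theorem exists_admissible : ∃ ε, S.Admissible ε := by
  obtain ⟨δ, -, h⟩ := S.exists_admissible_gt le_rfl
    (fun p _ q _ hpq => by simpa using hpq)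
    (fun p hp => abs_pos.2 (S.im_ne_zero_of_mem_poles hp))
  exact ⟨δ, h⟩

variable {S}

theorem Admissible.exists_gt {ε : ℝ} (h : S.Admissible ε) : ∃ δ, ε < δ ∧ S.Admissible δ := by
  obtain ⟨h0, h1, h2⟩ := S.admissible_iff.1 h
  exact S.exists_admissible_gt h0.le h1 h2

theorem Admissible.index_unique {ε : ℝ} (h : S.Admissible ε) {p q : S.Idx ⊕ S.Idx} {l : ℂ}
    (hp : l ∈ Metric.closedBall (S.pole p) ε) (hq : l ∈ Metric.closedBall (S.pole q) ε) :
    p = q := by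
  by_contra hpq
  exact (h.2.1 (S.pole_mem p) (S.pole_mem q) (S.pole_injective.ne hpq)).le_bot ⟨hp, hq⟩

theorem Admissible.ne_zero {ε : ℝ} (h : S.Admissible ε) {p : S.Idx ⊕ S.Idx} {l : ℂ}
    (hp : l ∈ Metric.closedBall (S.pole p) ε) : l ≠ 0 := by
  rintro rfl
  exact h.2.2 _ (S.pole_mem p) 0 (by simpa using hp)

theorem mem_disks {ε : ℝ} {l : ℂ} :
    l ∈ S.disks ε ↔ ∃ p, l ∈ Metric.closedBall (S.pole p) ε := by
  rw [disks, ← range_pole, biUnion_range, mem_iUnion]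

theorem mem_contour {ε : ℝ} {l : ℂ} :
    l ∈ S.contour ε ↔ ∃ p, l ∈ Metric.sphere (S.pole p) ε := by
  rw [contour, ← range_pole, biUnion_range, mem_iUnion]

theorem contour_subset_disks (ε : ℝ) : S.contour ε ⊆ S.disks ε := fun l hl => by
  obtain ⟨p, hp⟩ := mem_contour.1 hl
  exact mem_disks.2 ⟨p, Metric.sphere_subset_closedBall hp⟩

theorem isClosed_disks (ε : ℝ) : IsClosed (S.disks ε) :=
  S.poles_finite.isClosed_biUnion fun _ _ => Metric.isClosed_closedBall

theorem isClosed_contour (ε : ℝ) : IsClosed (S.contour ε) :=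
  S.poles_finite.isClosed_biUnion fun _ _ => Metric.isClosed_sphere

theorem isBounded_disks (ε : ℝ) : Bornology.IsBounded (S.disks ε) :=
  (Bornology.isBounded_biUnion S.poles_finite).2 fun _ _ => Metric.isBounded_closedBall

theorem eventually_notMem_disks (ε : ℝ) : ∀ᶠ l in Bornology.cobounded ℂ, l ∉ S.disks ε :=
  isBounded_disks ε

theorem poles_subset_disks {ε : ℝ} (hε : 0 < ε) : S.poles ⊆ S.disks ε := fun l hl => by
  rw [← range_pole] at hl
  obtain ⟨p, rfl⟩ := hl
  exact mem_disks.2 ⟨p, Metric.mem_closedBall_self hε.le⟩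

theorem Admissible.zero_notMem_disks {ε : ℝ} (h : S.Admissible ε) : (0 : ℂ) ∉ S.disks ε :=
  fun h0 => by
    obtain ⟨p, hp⟩ := mem_disks.1 h0
    exact h.ne_zero hp rfl

theorem Admissible.notMem_disks_of_lt {ε δ : ℝ} (hεδ : ε < δ) (h : S.Admissible δ)
    {p : S.Idx ⊕ S.Idx} {l : ℂ} (hl : l ∈ Metric.closedBall (S.pole p) δ)
    (hl' : l ∉ Metric.closedBall (S.pole p) ε) : l ∉ S.disks ε := fun hd => by
  obtain ⟨q, hq⟩ := mem_disks.1 hd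
  obtain rfl := h.index_unique hl (Metric.closedBall_subset_closedBall hεδ.le hq)
  exact hl' hq

theorem Admissible.notMem_contour_of_lt {ε δ : ℝ} (hεδ : ε < δ) (h : S.Admissible δ)
    {p : S.Idx ⊕ S.Idx} {l : ℂ} (hl : l ∈ Metric.closedBall (S.pole p) δ)
    (hl' : l ∉ Metric.sphere (S.pole p) ε) : l ∉ S.contour ε := fun hd => by
  obtain ⟨q, hq⟩ := mem_contour.1 hd
  obtain rfl := h.index_unique hl
    (Metric.closedBall_subset_closedBall hεδ.le (Metric.sphere_subset_closedBall hq))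
  exact hl' hq

theorem Admissible.notMem_poles {δ : ℝ} (h : S.Admissible δ) {p : S.Idx ⊕ S.Idx} {l : ℂ}
    (hl : l ∈ Metric.closedBall (S.pole p) δ) (hlp : l ≠ S.pole p) : l ∉ S.poles := fun hd => by
  rw [← range_pole] at hd
  obtain ⟨q, rfl⟩ := hd
  exact hlp (by rw [h.index_unique hl (Metric.mem_closedBall_self h.1.le)])

variable (S)

/-! ### The residue form in unified notation -/

/-- The nilpotent matrix in the residue condition at a pole. -/
def nil : S.Idx ⊕ S.Idx → Mat := Sum.elim (fun _ => !![0, 0; 1, 0]) fun _ => !![0, 1; 0, 0]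

/-- The coefficient of the nilpotent matrix in the residue condition at a pole. -/
noncomputable def amp (Dm t z : ℝ) : S.Idx ⊕ S.Idx → ℂ → ℂ :=
  Sum.elim (fun i l => S.normingConst i * Complex.exp (-2 * Complex.I * θ Dm t z l))
    fun i l => -conj (S.normingConst i) * Complex.exp (2 * Complex.I * θ Dm t z l)

theorem nil_mul_nil (p : S.Idx ⊕ S.Idx) : S.nil p * S.nil p = 0 := by
  rcases p with i | i <;> ext a b <;> fin_cases a <;> fin_cases b <;> simp [nil]

theorem amp_smul_nil_inl (Dm t z : ℝ) (i : S.Idx) (l : ℂ) :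
    S.amp Dm t z (Sum.inl i) l • S.nil (Sum.inl i) =
      !![0, 0; S.normingConst i * Complex.exp (-2 * Complex.I * θ Dm t z l), 0] := by
  simp [amp, nil]

theorem amp_smul_nil_inr (Dm t z : ℝ) (i : S.Idx) (l : ℂ) :
    S.amp Dm t z (Sum.inr i) l • S.nil (Sum.inr i) =
      !![0, -conj (S.normingConst i) * Complex.exp (2 * Complex.I * θ Dm t z l); 0, 0] := by
  simp [amp, nil]

theorem differentiableAt_amp (Dm t z : ℝ) (p : S.Idx ⊕ S.Idx) {l : ℂ} (hl : l ≠ 0) :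
    DifferentiableAt ℂ (S.amp Dm t z p) l := by
  have h : DifferentiableAt ℂ (θ Dm t z) l := by
    unfold θ
    refine (differentiableAt_id.mul_const _).sub (((differentiableAt_const _).div
      (differentiableAt_id.const_mul _) ?_).mul_const _)
    simpa using hl
  rcases p with i | i
  · exact ((h.const_mul (-2 * Complex.I)).cexp).const_mul _
  · exact ((h.const_mul (2 * Complex.I)).cexp).const_mul _

theorem tendsto_amp (Dm t z : ℝ) (p : S.Idx ⊕ S.Idx) :
    Tendsto (S.amp Dm t z p) (𝓝[≠] (S.pole p)) (𝓝 (S.amp Dm t z p (S.pole p))) :=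
  (S.differentiableAt_amp Dm t z p (S.pole_ne_zero p)).continuousAt.tendsto.mono_left
    nhdsWithin_le_nhds

/-- The residue conditions with a unified notation for the two kinds of poles. -/
structure HasResidueConditions (Dm t z : ℝ) (M : ℂ → Mat) : Prop where
  analytic : ∀ a b, DifferentiableOn ℂ (fun l => M l a b) S.polesᶜ
  normalized : NormalizedAtInfinity M
  residue : ∀ p, ∃ R : Mat, HasSimplePoleResidue M (S.pole p) R ∧
    Tendsto (fun l => M l * (S.amp Dm t z p l • S.nil p)) (𝓝[≠] (S.pole p)) (𝓝 R)

theorem isResidueSolution_iff {Dm t z : ℝ} {M : ℂ → Mat} : S.IsResidueSolution Dm t z M ↔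
    (∀ a b, Meromorphic fun l => M l a b) ∧ S.HasResidueConditions Dm t z M := by
  constructor
  · rintro ⟨h1, h2, h3, h4, h5⟩
    refine ⟨h1, h2, h3, ?_⟩
    rintro (⟨j, k⟩ | ⟨j, k⟩)
    · simp only [amp_smul_nil_inl]; exact h4 j k
    · simp only [amp_smul_nil_inr]; exact h5 j k
  · rintro ⟨h1, h2, h3, h4⟩
    refine ⟨h1, h2, h3, fun j k => ?_, fun j k => ?_⟩
    · have := h4 (Sum.inl ⟨j, k⟩)
      simp only [amp_smul_nil_inl] at this
      exact this
    · have := h4 (Sum.inr ⟨j, k⟩)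
      simp only [amp_smul_nil_inr] at this
      exact this

/-- The soliton solution of the residue form. -/
noncomputable def residueSolution (Dm t z : ℝ) : ℂ → Mat :=
  solitonMatrix S.lam (norming S.lam S.normingConst Dm t z)

theorem amp_inr_pole (Dm t z : ℝ) (i : S.Idx) : S.amp Dm t z (Sum.inr i) (conj (S.lam i)) =
    -conj (norming S.lam S.normingConst Dm t z i) := by
  simp [amp, norming, θ, ← Complex.exp_conj, Complex.conj_ofNat]

theorem residueSolution_hasResidueConditions (Dm t z : ℝ) :
    S.HasResidueConditions Dm t z (S.residueSolution Dm t z) := by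
  refine ⟨fun a b l hl => ?_, solitonMatrix_normalized _ _, ?_⟩
  · rw [poles_eq] at hl
    exact (solitonMatrix_differentiableAt _ hl a b).differentiableWithinAt
  · rintro (i | i)
    · simp only [amp_smul_nil_inl]
      exact solitonMatrix_residue_upper S.lam_injective S.lam_im_pos _ i
        (S.tendsto_amp Dm t z (Sum.inl i))
    · simp only [amp_smul_nil_inr]
      have := S.tendsto_amp Dm t z (Sum.inr i)
      rw [show S.pole (Sum.inr i) = conj (S.lam i) from rfl, amp_inr_pole] at this
      exact solitonMatrix_residue_lower S.lam_injective S.lam_im_pos _ i this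

theorem residueSolution_isResidueSolution (Dm t z : ℝ) :
    S.IsResidueSolution Dm t z (S.residueSolution Dm t z) :=
  S.isResidueSolution_iff.2 ⟨solitonMatrix_meromorphic _ _,
    S.residueSolution_hasResidueConditions Dm t z⟩

variable {S}

/-- Each row of the difference vanishes at infinity and inherits the residue conditions, which are
linear. -/
theorem HasResidueConditions.eqOn {Dm t z : ℝ} {M M' : ℂ → Mat}
    (h : S.HasResidueConditions Dm t z M) (h' : S.HasResidueConditions Dm t z M') :
    EqOn M M' S.polesᶜ := by
  have hcomp : ∀ {α : Type} {F : Filter α} {X : α → Mat} {Y : Mat}, Tendsto X F (𝓝 Y) →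
      ∀ a b, Tendsto (fun x => X x a b) F (𝓝 (Y a b)) := tendsto_mat_iff.1
  have row : ∀ a : Fin 2, ∀ l ∉ conjPoints S.lam, M l a 0 - M' l a 0 = 0 ∧
      M l a 1 - M' l a 1 = 0 := by
    intro a
    have hd : ∀ b, DifferentiableOn ℂ (fun l => M l a b - M' l a b) (conjPoints S.lam)ᶜ := by
      intro b
      rw [← poles_eq]
      exact (h.analytic a b).sub (h'.analytic a b)
    have hz : ∀ b, Tendsto (fun l => M l a b - M' l a b) (Bornology.cobounded ℂ) (𝓝 0) := by
      intro b
      simpa using (hcomp h.normalized a b).sub (hcomp h'.normalized a b)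
    refine row_eq_zero_of_residues S.lam_injective S.lam_im_pos
      (c := norming S.lam S.normingConst Dm t z)
      (h := fun i => S.amp Dm t z (Sum.inl i)) (k := fun i => S.amp Dm t z (Sum.inr i))
      (fun i => S.tendsto_amp Dm t z (Sum.inl i)) (fun i => ?_) (hd 0) (hd 1) (hz 0) (hz 1)
      (fun i => ?_) fun i => ?_
    · rw [← amp_inr_pole]
      exact S.tendsto_amp Dm t z (Sum.inr i)
    · obtain ⟨R, h1, h2⟩ := h.residue (Sum.inl i)
      obtain ⟨R', h1', h2'⟩ := h'.residue (Sum.inl i)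
      -- Right multiplication by the nilpotent matrix annihilates this column, so the residue is
      -- zero there.
      have e0 : ∀ {X : ℂ → Mat} {R : Mat}, Tendsto (fun l => X l *
          (S.amp Dm t z (Sum.inl i) l • S.nil (Sum.inl i))) (𝓝[≠] (S.pole (Sum.inl i))) (𝓝 R) →
          R a 1 = 0 := fun {X R} hX => by
        have := hcomp hX a 1
        simp only [amp_smul_nil_inl] at this
        simp [Matrix.mul_apply] at this
        exact this.symm
      refine ⟨R a 0 - R' a 0, ?_, ?_, ?_⟩
      · simpa [mul_sub] using! (hcomp h1 a 0).sub (hcomp h1' a 0)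
      · have := (hcomp h1 a 1).sub (hcomp h1' a 1)
        rw [e0 h2, e0 h2', sub_zero] at this
        simpa [mul_sub] using! this
      · have := (hcomp h2 a 0).sub (hcomp h2' a 0)
        refine this.congr fun l => ?_
        simp only [amp_smul_nil_inl]
        simp [Matrix.mul_apply, amp, sub_mul]
    · obtain ⟨R, h1, h2⟩ := h.residue (Sum.inr i)
      obtain ⟨R', h1', h2'⟩ := h'.residue (Sum.inr i)
      have e0 : ∀ {X : ℂ → Mat} {R : Mat}, Tendsto (fun l => X l *
          (S.amp Dm t z (Sum.inr i) l • S.nil (Sum.inr i))) (𝓝[≠] (S.pole (Sum.inr i))) (𝓝 R) →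
          R a 0 = 0 := fun {X R} hX => by
        have := hcomp hX a 0
        simp only [amp_smul_nil_inr] at this
        simp [Matrix.mul_apply] at this
        exact this.symm
      refine ⟨R a 1 - R' a 1, ?_, ?_, ?_⟩
      · have := (hcomp h1 a 0).sub (hcomp h1' a 0)
        rw [e0 h2, e0 h2', sub_zero] at this
        simpa [mul_sub] using! this
      · simpa [mul_sub] using! (hcomp h1 a 1).sub (hcomp h1' a 1)
      · have := (hcomp h2 a 1).sub (hcomp h2' a 1)
        refine this.congr fun l => ?_
        simp only [amp_smul_nil_inr]
        simp [Matrix.mul_apply, amp, sub_mul]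
        ring
  intro l hl
  rw [poles_eq] at hl
  ext a b
  fin_cases b
  · exact sub_eq_zero.1 (row a l hl).1
  · exact sub_eq_zero.1 (row a l hl).2

end MBE.SpectralData

namespace MBE.SpectralData

variable (S : SpectralData)

/-! ### The triangular factors -/

/-- The unipotent factor carrying the singularity of the residue form at a pole. -/
noncomputable def factor (Dm t z : ℝ) (p : S.Idx ⊕ S.Idx) (l : ℂ) : Mat :=
  1 + (S.amp Dm t z p l / (l - S.pole p)) • S.nil p

/-- The inverse of `factor`. -/
noncomputable def factorInv (Dm t z : ℝ) (p : S.Idx ⊕ S.Idx) (l : ℂ) : Mat :=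
  1 - (S.amp Dm t z p l / (l - S.pole p)) • S.nil p

theorem factor_mul_factorInv (Dm t z : ℝ) (p : S.Idx ⊕ S.Idx) (l : ℂ) :
    S.factor Dm t z p l * S.factorInv Dm t z p l = 1 := by
  simp [factor, factorInv, mul_sub, add_mul, nil_mul_nil]

theorem factorInv_mul_factor (Dm t z : ℝ) (p : S.Idx ⊕ S.Idx) (l : ℂ) :
    S.factorInv Dm t z p l * S.factor Dm t z p l = 1 := by
  simp [factor, factorInv, mul_add, sub_mul, nil_mul_nil]

theorem factor_mul_amp_nil (Dm t z : ℝ) (p : S.Idx ⊕ S.Idx) (l : ℂ) :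
    S.factor Dm t z p l * (S.amp Dm t z p l • S.nil p) = S.amp Dm t z p l • S.nil p := by
  simp [factor, add_mul, nil_mul_nil]

theorem V_eq (Dm t z : ℝ) (j : Fin S.J) (k : Fin (S.N j)) (l : ℂ) :
    S.V Dm t z j k l = S.factor Dm t z (Sum.inl ⟨j, k⟩) l := by
  ext a b
  fin_cases a <;> fin_cases b <;> simp [V, factor, amp, nil, pole, lam, normingConst]

/-- The amplitude at a lower pole carries a minus sign, so the adjoint is the inverse factor. All
circles thus share the jump matrix `factorInv`. -/
theorem V_conj_conjTranspose (Dm t z : ℝ) (j : Fin S.J) (k : Fin (S.N j)) (l : ℂ) :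
    (S.V Dm t z j k (conj l)).conjTranspose = S.factorInv Dm t z (Sum.inr ⟨j, k⟩) l := by
  ext a b
  fin_cases a <;> fin_cases b <;>
    simp [V, factorInv, amp, nil, pole, lam, normingConst, θ, ← Complex.exp_conj,
      Complex.conj_ofNat, neg_div]

theorem V_inv (Dm t z : ℝ) (j : Fin S.J) (k : Fin (S.N j)) (l : ℂ) :
    (S.V Dm t z j k l)⁻¹ = S.factorInv Dm t z (Sum.inl ⟨j, k⟩) l := by
  rw [V_eq]
  exact Matrix.inv_eq_right_inv (S.factor_mul_factorInv _ _ _ _ _)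

theorem V_conj_conjTranspose_inv (Dm t z : ℝ) (j : Fin S.J) (k : Fin (S.N j)) (l : ℂ) :
    ((S.V Dm t z j k (conj l)).conjTranspose)⁻¹ = S.factor Dm t z (Sum.inr ⟨j, k⟩) l := by
  rw [V_conj_conjTranspose]
  exact Matrix.inv_eq_right_inv (S.factorInv_mul_factor _ _ _ _ _)

theorem differentiableAt_amp_div (Dm t z : ℝ) (p : S.Idx ⊕ S.Idx) {l : ℂ} (hl : l ≠ 0)
    (hlp : l ≠ S.pole p) :
    DifferentiableAt ℂ (fun l => S.amp Dm t z p l / (l - S.pole p)) l :=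
  (S.differentiableAt_amp Dm t z p hl).div (differentiableAt_id.sub_const _) (sub_ne_zero.2 hlp)

theorem differentiableAt_factor (Dm t z : ℝ) (p : S.Idx ⊕ S.Idx) {l : ℂ} (hl : l ≠ 0)
    (hlp : l ≠ S.pole p) (a b : Fin 2) :
    DifferentiableAt ℂ (fun l => S.factor Dm t z p l a b) l :=
  ((S.differentiableAt_amp_div Dm t z p hl hlp).mul_const (S.nil p a b)).const_add _

theorem differentiableAt_factorInv (Dm t z : ℝ) (p : S.Idx ⊕ S.Idx) {l : ℂ} (hl : l ≠ 0)
    (hlp : l ≠ S.pole p) (a b : Fin 2) :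
    DifferentiableAt ℂ (fun l => S.factorInv Dm t z p l a b) l :=
  ((S.differentiableAt_amp_div Dm t z p hl hlp).mul_const (S.nil p a b)).const_sub _

theorem differentiableAt_mat_mul {M N : ℂ → Mat} {l : ℂ}
    (hM : ∀ a b, DifferentiableAt ℂ (fun l => M l a b) l)
    (hN : ∀ a b, DifferentiableAt ℂ (fun l => N l a b) l) (a b : Fin 2) :
    DifferentiableAt ℂ (fun l => (M l * N l) a b) l := by
  simp only [Matrix.mul_apply, Fin.sum_univ_two]
  exact ((hM a 0).mul (hN 0 b)).add ((hM a 1).mul (hN 1 b))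

theorem continuousAt_of_differentiableAt_entries {M : ℂ → Mat} {l : ℂ}
    (hM : ∀ a b, DifferentiableAt ℂ (fun l => M l a b) l) : ContinuousAt M l :=
  tendsto_mat_iff.2 fun a b => (hM a b).continuousAt

/-- The residue conditions hold for a regular function times the unipotent factor. -/
theorem residue_of_mul_factor {Dm t z : ℝ} {p : S.Idx ⊕ S.Idx} {M N : ℂ → Mat}
    (hN : ContinuousAt N (S.pole p))
    (hM : ∀ᶠ l in 𝓝[≠] (S.pole p), M l = N l * S.factor Dm t z p l) :
    ∃ R : Mat, HasSimplePoleResidue M (S.pole p) R ∧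
      Tendsto (fun l => M l * (S.amp Dm t z p l • S.nil p)) (𝓝[≠] (S.pole p)) (𝓝 R) := by
  have hN' : Tendsto N (𝓝[≠] (S.pole p)) (𝓝 (N (S.pole p))) :=
    hN.tendsto.mono_left nhdsWithin_le_nhds
  have h1 : Tendsto (fun l => N l * (S.amp Dm t z p l • S.nil p)) (𝓝[≠] (S.pole p))
      (𝓝 (N (S.pole p) * (S.amp Dm t z p (S.pole p) • S.nil p))) :=
    hN'.mul ((S.tendsto_amp Dm t z p).smul_const _)
  refine ⟨_, ?_, h1.congr' ?_⟩
  -- Multiplying the factor by `l - p` gives `(l - p) + amp • nil`, whose first term dies in the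
  -- limit.
  · have h2 := ((tendsto_sub_self_nhdsNE (S.pole p)).smul hN').add h1
    rw [zero_smul, zero_add] at h2
    refine h2.congr' ?_
    filter_upwards [hM, self_mem_nhdsWithin] with l hl hlp
    have : l - S.pole p ≠ 0 := sub_ne_zero.2 hlp
    rw [hl, factor, mul_add, mul_one, smul_add, mul_smul_comm, mul_smul_comm, smul_smul,
      mul_div_cancel₀ _ this]
  · filter_upwards [hM] with l hl
    rw [hl, mul_assoc, factor_mul_amp_nil]

/-! ### The jump form in unified notation -/

theorem isJumpSolution_iff {ε Dm t z : ℝ} {M : ℂ → Mat} : S.IsJumpSolution ε Dm t z M ↔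
    (∀ a b, DifferentiableOn ℂ (fun l => M l a b) (S.contour ε)ᶜ) ∧ NormalizedAtInfinity M ∧
    ∃ Mp Mm : ℂ → Mat, ContinuousOn Mp (S.contour ε) ∧ ContinuousOn Mm (S.contour ε) ∧
      ∀ p, ∀ ζ ∈ Metric.sphere (S.pole p) ε,
        Tendsto M (𝓝[Metric.ball (S.pole p) ε] ζ) (𝓝 (Mp ζ)) ∧
        Tendsto M (𝓝[(S.disks ε)ᶜ] ζ) (𝓝 (Mm ζ)) ∧
        Mp ζ = Mm ζ * S.factorInv Dm t z p ζ := by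
  constructor
  · rintro ⟨h1, h2, Mp, Mm, h3, h4, h5, h6, h7⟩
    refine ⟨h1, h2, Mp, Mm, h3, h4, fun p ζ hζ => ?_⟩
    obtain ⟨h8, h9⟩ := h5 _ (S.pole_mem p) ζ hζ
    refine ⟨h8, h9, ?_⟩
    rcases p with ⟨j, k⟩ | ⟨j, k⟩
    · rw [← V_inv]; exact h6 j k ζ hζ
    · rw [← V_conj_conjTranspose]; exact h7 j k ζ hζ
  · rintro ⟨h1, h2, Mp, Mm, h3, h4, h5⟩
    refine ⟨h1, h2, Mp, Mm, h3, h4, fun q hq ζ hζ => ?_, fun j k ζ hζ => ?_, fun j k ζ hζ => ?_⟩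
    · rw [← range_pole] at hq
      obtain ⟨p, rfl⟩ := hq
      exact ⟨(h5 p ζ hζ).1, (h5 p ζ hζ).2.1⟩
    · rw [V_inv]; exact (h5 (Sum.inl ⟨j, k⟩) ζ hζ).2.2
    · rw [V_conj_conjTranspose]; exact (h5 (Sum.inr ⟨j, k⟩) ζ hζ).2.2

/-! ### Gluing: passage between the residue form and the jump form -/

open Classical in
/-- The function equal to `N p` on the closed disk around pole `p` and to `M` elsewhere. -/
noncomputable def glue (ε : ℝ) (N : S.Idx ⊕ S.Idx → ℂ → Mat) (M : ℂ → Mat) (l : ℂ) : Mat :=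
  if h : ∃ p, l ∈ Metric.closedBall (S.pole p) ε then N h.choose l else M l

variable {S}

theorem Admissible.glue_of_mem {ε : ℝ} (h : S.Admissible ε) (N : S.Idx ⊕ S.Idx → ℂ → Mat)
    (M : ℂ → Mat) {p : S.Idx ⊕ S.Idx} {l : ℂ} (hl : l ∈ Metric.closedBall (S.pole p) ε) :
    S.glue ε N M l = N p l := by
  have hex : ∃ p, l ∈ Metric.closedBall (S.pole p) ε := ⟨p, hl⟩
  rw [glue, dif_pos hex, h.index_unique hex.choose_spec hl]

theorem glue_of_notMem {ε : ℝ} (N : S.Idx ⊕ S.Idx → ℂ → Mat) (M : ℂ → Mat) {l : ℂ}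
    (hl : l ∉ S.disks ε) : S.glue ε N M l = M l :=
  dif_neg fun h => hl (mem_disks.2 h)

theorem normalizedAtInfinity_congr {ε : ℝ} {M M' : ℂ → Mat} (h : NormalizedAtInfinity M)
    (hM : ∀ l ∉ S.disks ε, M' l = M l) : NormalizedAtInfinity M' := by
  refine h.congr' ?_
  filter_upwards [eventually_notMem_disks ε] with l hl
  exact (hM l hl).symm

/-- From the residue form to the jump form. -/
theorem HasResidueConditions.exists_isJumpSolution {Dm t z : ℝ} {M : ℂ → Mat}
    (h : S.HasResidueConditions Dm t z M) {ε : ℝ} (hε : S.Admissible ε) :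
    ∃ Mj, S.IsJumpSolution ε Dm t z Mj := by
  obtain ⟨δ, hεδ, hδ⟩ := hε.exists_gt
  have hMd : ∀ l ∉ S.poles, ∀ a b, DifferentiableAt ℂ (fun l => M l a b) l := fun l hl a b =>
    (h.analytic a b).differentiableAt (S.poles_finite.isClosed.isOpen_compl.mem_nhds hl)
  -- `(l - p) • M` and `M * (amp • nil)` have the same limit, so `M * factorInv` has a removable
  -- singularity. The larger radius `δ` makes the extension continuous up to the circle.
  have hN : ∀ p, ∃ N : ℂ → Mat,
      (∀ a b, DifferentiableOn ℂ (fun l => N l a b) (Metric.ball (S.pole p) δ)) ∧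
      ∀ l, l ≠ S.pole p → N l = M l * S.factorInv Dm t z p l := by
    intro p
    obtain ⟨R, hR1, hR2⟩ := h.residue p
    have hlim : Tendsto (fun l => (l - S.pole p) • (M l * S.factorInv Dm t z p l))
        (𝓝[≠] (S.pole p)) (𝓝 0) := by
      have := hR1.sub hR2
      rw [sub_self] at this
      refine this.congr' ?_
      filter_upwards [self_mem_nhdsWithin] with l hlp
      have : l - S.pole p ≠ 0 := sub_ne_zero.2 hlp
      rw [factorInv, mul_sub, mul_one, smul_sub, mul_smul_comm, mul_smul_comm, smul_smul,
        mul_div_cancel₀ _ this]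
    have hext : ∀ a b, ∃ g : ℂ → ℂ, DifferentiableOn ℂ g (Metric.ball (S.pole p) δ) ∧
        ∀ l, l ≠ S.pole p → g l = (M l * S.factorInv Dm t z p l) a b := by
      intro a b
      refine exists_differentiableOn_extension (Metric.ball_mem_nhds _ hδ.1) (fun l hl => ?_)
        (tendsto_mat_iff.1 hlim a b)
      have hl' := Metric.ball_subset_closedBall hl.1
      exact (differentiableAt_mat_mul (hMd l (hδ.notMem_poles hl' hl.2))
        (S.differentiableAt_factorInv Dm t z p (hδ.ne_zero hl') hl.2) a b).differentiableWithinAt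
    choose g hg1 hg2 using hext
    exact ⟨fun l => Matrix.of fun a b => g a b l, hg1,
      fun l hl => by ext a b; exact hg2 a b l hl⟩
  choose N hN1 hN2 using hN
  have hNc : ∀ p, ∀ l ∈ Metric.closedBall (S.pole p) ε, ContinuousAt (N p) l := fun p l hl =>
    continuousAt_of_differentiableAt_entries fun a b =>
      (hN1 p a b).differentiableAt (Metric.isOpen_ball.mem_nhds
        (Metric.closedBall_subset_ball hεδ hl))
  have hcont : ∀ p, ∀ l ∈ Metric.sphere (S.pole p) ε, l ∉ S.poles := fun p l hl =>
    hε.notMem_poles (Metric.sphere_subset_closedBall hl) (Metric.ne_of_mem_sphere hl hε.1.ne')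
  have hin : ∀ {p l}, l ∈ Metric.closedBall (S.pole p) ε → S.glue ε N M l = N p l :=
    fun hl => hε.glue_of_mem N M hl
  have hMm : ∀ l ∈ S.contour ε, ContinuousAt M l := fun l hl => by
    obtain ⟨p, hp⟩ := mem_contour.1 hl
    exact continuousAt_of_differentiableAt_entries (hMd l (hcont p l hp))
  refine ⟨S.glue ε N M, S.isJumpSolution_iff.2 ⟨fun a b l hl => ?_,
    normalizedAtInfinity_congr h.normalized fun l hl => glue_of_notMem N M hl,
    S.glue ε N M, M, ?_, fun l hl => (hMm l hl).continuousWithinAt,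
    fun p ζ hζ => ⟨?_, ?_, ?_⟩⟩⟩
  · refine DifferentiableAt.differentiableWithinAt ?_
    by_cases hd : l ∈ S.disks ε
    · obtain ⟨p, hp⟩ := mem_disks.1 hd
      have hb : l ∈ Metric.ball (S.pole p) ε :=
        lt_of_le_of_ne (Metric.mem_closedBall.1 hp) fun e => hl (mem_contour.2 ⟨p, e⟩)
      refine ((hN1 p a b).differentiableAt (Metric.isOpen_ball.mem_nhds
        (Metric.ball_subset_ball hεδ.le hb))).congr_of_eventuallyEq ?_
      filter_upwards [Metric.isOpen_ball.mem_nhds hb] with x hx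
      rw [hin (Metric.ball_subset_closedBall hx)]
    · refine (hMd l (fun h => hd (poles_subset_disks hε.1 h)) a b).congr_of_eventuallyEq ?_
      filter_upwards [(isClosed_disks ε).isOpen_compl.mem_nhds hd] with x hx
      rw [glue_of_notMem N M hx]
  · intro l hl
    obtain ⟨p, hp⟩ := mem_contour.1 hl
    have hloc : Metric.ball (S.pole p) δ ∩ S.contour ε ∈ 𝓝[S.contour ε] l :=
      inter_mem (mem_nhdsWithin_of_mem_nhds (Metric.isOpen_ball.mem_nhds
        (Metric.closedBall_subset_ball hεδ (Metric.sphere_subset_closedBall hp))))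
        self_mem_nhdsWithin
    have hpc := Metric.sphere_subset_closedBall hp
    refine ((hNc p l hpc).continuousWithinAt (s := S.contour ε)).congr_of_eventuallyEq ?_
      (hin hpc)
    filter_upwards [hloc] with x hx
    refine hin (Metric.sphere_subset_closedBall (by_contra fun hx' => ?_))
    exact hδ.notMem_contour_of_lt hεδ (Metric.ball_subset_closedBall hx.1) hx' hx.2
  · have hc := Metric.sphere_subset_closedBall hζ
    rw [hin hc]
    refine ((hNc p ζ hc).tendsto.mono_left nhdsWithin_le_nhds).congr' ?_
    filter_upwards [self_mem_nhdsWithin] with x hx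
    rw [hin (Metric.ball_subset_closedBall hx)]
  · refine ((hMm ζ (mem_contour.2 ⟨p, hζ⟩)).tendsto.mono_left nhdsWithin_le_nhds).congr' ?_
    filter_upwards [self_mem_nhdsWithin] with x hx
    rw [glue_of_notMem N M hx]
  · rw [hin (Metric.sphere_subset_closedBall hζ),
      hN2 p ζ (Metric.ne_of_mem_sphere hζ hε.1.ne')]

/-- From the jump form to the residue form. -/
theorem IsJumpSolution.exists_hasResidueConditions {ε Dm t z : ℝ} {M : ℂ → Mat}
    (h : S.IsJumpSolution ε Dm t z M) (hε : S.Admissible ε) :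
    ∃ Mr, S.HasResidueConditions Dm t z Mr ∧ (∀ l ∉ S.disks ε, Mr l = M l) ∧
      ∀ p, ∀ l ∈ Metric.ball (S.pole p) ε, Mr l = M l * S.factor Dm t z p l := by
  classical
  obtain ⟨δ, hεδ, hδ⟩ := hε.exists_gt
  obtain ⟨h1, h2, Mp, Mm, h3, -, h5⟩ := S.isJumpSolution_iff.1 h
  have hMd : ∀ l ∉ S.contour ε, ∀ a b, DifferentiableAt ℂ (fun l => M l a b) l := fun l hl a b =>
    (h1 a b).differentiableAt ((isClosed_contour ε).isOpen_compl.mem_nhds hl)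
  -- `N p` continues the inner function across the circle by means of the jump relation.
  let N : S.Idx ⊕ S.Idx → ℂ → Mat := fun p l =>
    if l ∈ Metric.ball (S.pole p) ε then M l else
      if l ∈ Metric.sphere (S.pole p) ε then Mp l else M l * S.factorInv Dm t z p l
  have hNb : ∀ {p l}, l ∈ Metric.ball (S.pole p) ε → N p l = M l := fun hl => if_pos hl
  have hNs : ∀ {p l}, l ∈ Metric.sphere (S.pole p) ε → N p l = Mp l := fun {p l} hl => by
    have : l ∉ Metric.ball (S.pole p) ε := fun hb => hb.ne hl
    simp only [N, if_neg this, if_pos hl]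
  have hNo : ∀ {p l}, l ∉ Metric.closedBall (S.pole p) ε →
      N p l = M l * S.factorInv Dm t z p l := fun {p l} hl => by
    have hb : l ∉ Metric.ball (S.pole p) ε := fun hb => hl (Metric.ball_subset_closedBall hb)
    have hs : l ∉ Metric.sphere (S.pole p) ε := fun hb => hl (Metric.sphere_subset_closedBall hb)
    simp only [N, if_neg hb, if_neg hs]
  have hNd : ∀ p, ∀ l ∈ Metric.closedBall (S.pole p) δ, l ∉ Metric.sphere (S.pole p) ε →
      ∀ a b, DifferentiableAt ℂ (fun l => N p l a b) l := by
    intro p l hl hls a b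
    have hM := hMd l (hδ.notMem_contour_of_lt hεδ hl hls)
    by_cases hb : l ∈ Metric.ball (S.pole p) ε
    · refine (hM a b).congr_of_eventuallyEq ?_
      filter_upwards [Metric.isOpen_ball.mem_nhds hb] with x hx
      rw [hNb hx]
    · have hc : l ∉ Metric.closedBall (S.pole p) ε := fun hc =>
        hb (lt_of_le_of_ne (Metric.mem_closedBall.1 hc) hls)
      have hlp : l ≠ S.pole p := by
        rintro rfl
        exact hc (Metric.mem_closedBall_self hε.1.le)
      refine (differentiableAt_mat_mul hM (S.differentiableAt_factorInv Dm t z p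
        (hδ.ne_zero hl) hlp) a b).congr_of_eventuallyEq ?_
      filter_upwards [Metric.isClosed_closedBall.isOpen_compl.mem_nhds hc] with x hx
      rw [hNo hx]
  have hNcs : ∀ p, ∀ ζ ∈ Metric.sphere (S.pole p) ε, ContinuousAt (N p) ζ := by
    intro p ζ hζ
    obtain ⟨t1, t2, e⟩ := h5 p ζ hζ
    have hζp := Metric.ne_of_mem_sphere hζ hε.1.ne'
    have hζc := Metric.sphere_subset_closedBall hζ
    have cover : (univ : Set ℂ) = (Metric.ball (S.pole p) ε ∪ Metric.sphere (S.pole p) ε) ∪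
        (Metric.closedBall (S.pole p) ε)ᶜ := by
      rw [Metric.ball_union_sphere, union_compl_self]
    rw [ContinuousAt, hNs hζ, ← nhdsWithin_univ, cover, nhdsWithin_union, nhdsWithin_union]
    refine (Tendsto.sup (t1.congr' ?_) ?_).sup ?_
    · filter_upwards [self_mem_nhdsWithin] with x hx
      exact (hNb hx).symm
    · have hsub : Metric.sphere (S.pole p) ε ⊆ S.contour ε := fun x hx => mem_contour.2 ⟨p, hx⟩
      refine ((h3 ζ (hsub hζ)).mono_left (nhdsWithin_mono _ hsub)).congr' ?_
      filter_upwards [self_mem_nhdsWithin] with x hx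
      exact (hNs hx).symm
    -- Near `ζ` the other disks are absent, so leaving this disk means leaving all of them.
    · have hle : 𝓝[(Metric.closedBall (S.pole p) ε)ᶜ] ζ ≤ 𝓝[(S.disks ε)ᶜ] ζ := by
        rw [nhdsWithin_le_iff]
        filter_upwards [self_mem_nhdsWithin, mem_nhdsWithin_of_mem_nhds
          (Metric.isOpen_ball.mem_nhds (Metric.closedBall_subset_ball hεδ hζc))] with x hx hx'
        exact hδ.notMem_disks_of_lt hεδ (Metric.ball_subset_closedBall hx') hx
      have hF : ContinuousAt (S.factorInv Dm t z p) ζ :=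
        continuousAt_of_differentiableAt_entries
          (S.differentiableAt_factorInv Dm t z p (hε.ne_zero hζc) hζp)
      rw [e]
      refine ((t2.mono_left hle).mul (hF.tendsto.mono_left nhdsWithin_le_nhds)).congr' ?_
      filter_upwards [self_mem_nhdsWithin] with x hx
      exact (hNo hx).symm
  have hNc : ∀ p, ∀ l ∈ Metric.closedBall (S.pole p) δ, ContinuousAt (N p) l := fun p l hl => by
    by_cases hs : l ∈ Metric.sphere (S.pole p) ε
    · exact hNcs p l hs
    · exact continuousAt_of_differentiableAt_entries (hNd p l hl hs)
  have hNdiff : ∀ p a b, DifferentiableOn ℂ (fun l => N p l a b) (Metric.ball (S.pole p) δ) :=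
    fun p a b => differentiableOn_ball_of_continuousOn_of_off_sphere hε.1 hεδ
      (fun l hl => ContinuousAt.continuousWithinAt (tendsto_mat_iff.1 (hNc p l hl) a b))
      fun l hl hs => hNd p l (Metric.ball_subset_closedBall hl) hs a b
  set Mr := S.glue ε (fun p l => N p l * S.factor Dm t z p l) M
  have hout : ∀ l ∉ S.disks ε, Mr l = M l := fun l hl => glue_of_notMem _ M hl
  -- In the annulus beyond the circle the factor and its inverse cancel, so one formula describes
  -- `Mr` on both sides.
  have hloc : ∀ p, ∀ l ∈ Metric.ball (S.pole p) δ, Mr l = N p l * S.factor Dm t z p l := by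
    intro p l hl
    by_cases hc : l ∈ Metric.closedBall (S.pole p) ε
    · exact hε.glue_of_mem _ M hc
    · rw [hout l (hδ.notMem_disks_of_lt hεδ (Metric.ball_subset_closedBall hl) hc), hNo hc,
        mul_assoc, factorInv_mul_factor, mul_one]
  refine ⟨Mr, ⟨fun a b l hl => DifferentiableAt.differentiableWithinAt ?_,
    normalizedAtInfinity_congr h2 hout, fun p => ?_⟩, hout, fun p l hl => ?_⟩
  · by_cases hd : l ∈ S.disks ε
    · obtain ⟨p, hp⟩ := mem_disks.1 hd
      have hb := Metric.isOpen_ball.mem_nhds (Metric.closedBall_subset_ball hεδ hp)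
      have hlp : l ≠ S.pole p := fun e => hl (e ▸ S.pole_mem p)
      refine (differentiableAt_mat_mul (fun a b => (hNdiff p a b).differentiableAt hb)
        (S.differentiableAt_factor Dm t z p (hε.ne_zero hp) hlp) a b).congr_of_eventuallyEq ?_
      filter_upwards [hb] with x hx
      rw [hloc p x hx]
    · refine (hMd l (fun h => hd (contour_subset_disks ε h)) a b).congr_of_eventuallyEq ?_
      filter_upwards [(isClosed_disks ε).isOpen_compl.mem_nhds hd] with x hx
      rw [hout x hx]
  · refine S.residue_of_mul_factor (hNc p _ (Metric.mem_closedBall_self hδ.1.le)) ?_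
    filter_upwards [mem_nhdsWithin_of_mem_nhds (Metric.ball_mem_nhds _ hδ.1)] with x hx
    exact hloc p x hx
  · rw [hloc p l (Metric.ball_subset_ball hεδ.le hl), hNb hl]

end MBE.SpectralData

/-! ### Correspondence, uniqueness for the jump form, and reconstruction -/

namespace MBE.SpectralData

variable {S : SpectralData}

theorem IsResidueSolution.hasResidueConditions {Dm t z : ℝ} {M : ℂ → Mat}
    (h : S.IsResidueSolution Dm t z M) : S.HasResidueConditions Dm t z M :=
  (S.isResidueSolution_iff.1 h).2

/-- A solution of the jump form is determined by a solution of the residue form. -/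
theorem IsJumpSolution.eq_of_hasResidueConditions {ε Dm t z : ℝ} {Mr Mj : ℂ → Mat}
    (hj : S.IsJumpSolution ε Dm t z Mj) (hε : S.Admissible ε)
    (hr : S.HasResidueConditions Dm t z Mr) :
    (∀ l ∉ S.disks ε, Mr l = Mj l) ∧ ∀ p, ∀ l ∈ Metric.ball (S.pole p) ε, l ≠ S.pole p →
      Mr l = Mj l * S.factor Dm t z p l := by
  obtain ⟨M, hM, hout, hin⟩ := hj.exists_hasResidueConditions hε
  have e := hr.eqOn hM
  refine ⟨fun l hl => ?_, fun p l hl hlp => ?_⟩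
  · rw [e fun h => hl (poles_subset_disks hε.1 h), hout l hl]
  · rw [e (hε.notMem_poles (Metric.ball_subset_closedBall hl) hlp), hin p l hl]

theorem IsJumpSolution.corresponds {ε Dm t z : ℝ} {Mr Mj : ℂ → Mat}
    (hj : S.IsJumpSolution ε Dm t z Mj) (hε : S.Admissible ε)
    (hr : S.HasResidueConditions Dm t z Mr) : S.Corresponds ε Dm t z Mr Mj := by
  obtain ⟨h1, h2⟩ := hj.eq_of_hasResidueConditions hε hr
  refine ⟨h1, fun j k l hl hlp => ?_, fun j k l hl hlp => ?_⟩
  · rw [V_eq]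
    exact h2 (Sum.inl ⟨j, k⟩) l hl hlp
  · rw [V_conj_conjTranspose_inv]
    exact h2 (Sum.inr ⟨j, k⟩) l hl hlp

/-- Both solutions are compared with the same residue-form solution, and the invertible factor
cancels. At the centres, where the factor is singular, continuity decides. -/
theorem IsJumpSolution.eqOn {ε Dm t z : ℝ} {M M' : ℂ → Mat}
    (h : S.IsJumpSolution ε Dm t z M) (h' : S.IsJumpSolution ε Dm t z M')
    (hε : S.Admissible ε) : EqOn M M' (S.contour ε)ᶜ := by
  have hr := S.residueSolution_hasResidueConditions Dm t z
  obtain ⟨h1, h2⟩ := h.eq_of_hasResidueConditions hε hr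
  obtain ⟨h1', h2'⟩ := h'.eq_of_hasResidueConditions hε hr
  have hne : ∀ p, ∀ l ∈ Metric.ball (S.pole p) ε, l ≠ S.pole p → M l = M' l := by
    intro p l hl hlp
    have := (h2 p l hl hlp).symm.trans (h2' p l hl hlp)
    rw [← mul_one (M l), ← mul_one (M' l), ← S.factor_mul_factorInv Dm t z p l, ← mul_assoc,
      ← mul_assoc, this]
  intro l hl
  by_cases hd : l ∈ S.disks ε
  · obtain ⟨p, hp⟩ := mem_disks.1 hd
    have hb : l ∈ Metric.ball (S.pole p) ε :=
      lt_of_le_of_ne (Metric.mem_closedBall.1 hp) fun e => hl (mem_contour.2 ⟨p, e⟩)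
    by_cases hlp : l = S.pole p
    · have hc : ∀ {X : ℂ → Mat}, S.IsJumpSolution ε Dm t z X →
          Tendsto X (𝓝[≠] l) (𝓝 (X l)) := fun {X} hX =>
        (continuousAt_of_differentiableAt_entries fun a b => (hX.analytic a b).differentiableAt
          ((isClosed_contour ε).isOpen_compl.mem_nhds hl)).tendsto.mono_left nhdsWithin_le_nhds
      refine tendsto_nhds_unique (hc h) ((hc h').congr' ?_)
      filter_upwards [mem_nhdsWithin_of_mem_nhds (Metric.isOpen_ball.mem_nhds hb),
        self_mem_nhdsWithin] with x hx hxl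
      exact (hne p x hx fun e => hxl (e.trans hlp.symm)).symm
    · exact hne p l hb hlp
  · rw [← h1 l hd, h1' l hd]

/-! ### The reconstruction formula -/

variable (S) in
/-- The soliton triple of the spectral data. -/
noncomputable def fields (Dm : ℝ) : Fields := solitonFields S.lam S.normingConst Dm

theorem isUnit_and_density_at_origin (Dm t z : ℝ) : IsUnit (S.residueSolution Dm t z 0) ∧
    (Dm : ℂ) • (S.residueSolution Dm t z 0 * σ₃ * (S.residueSolution Dm t z 0)⁻¹) =
      (S.fields Dm).ρ t z := by
  set a := originA S.lam (norming S.lam S.normingConst Dm t z)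
  set b := originB S.lam (norming S.lam S.normingConst Dm t z)
  have hu : a * conj a + b * conj b = 1 := origin_unitary S.lam_im_pos _
  have h0 : S.residueSolution Dm t z 0 = !![a, b; -conj b, conj a] := solitonMatrix_zero _ _
  have hinv : S.residueSolution Dm t z 0 * !![conj a, -b; conj b, a] = 1 := by
    rw [h0]
    ext i j
    fin_cases i <;> fin_cases j <;> simp [Matrix.mul_apply]
    · linear_combination hu
    · ring
    · ring
    · linear_combination hu
  refine ⟨IsUnit.of_mul_eq_one _ hinv, ?_⟩
  have hD : ((S.fields Dm).D t z : ℂ) = Dm * (a * conj a - b * conj b) :=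
    solitonFields_D_eq _ _ _ _ _
  have hP : (S.fields Dm).P t z = -2 * Dm * a * b := rfl
  rw [Matrix.inv_eq_right_inv hinv, h0, Fields.ρ, hD, hP]
  ext i j
  fin_cases i <;> fin_cases j <;> simp [σ₃, Complex.conj_ofNat] <;>
    first | ring1 | exact Or.inl (by ring1)

/-- The reconstruction formula applied to any function that agrees with the solution of the
residue form at the origin and near infinity. -/
theorem reconstructedAt_iff {Dm t z : ℝ} {M : ℂ → Mat} (s : Fields)
    (h0 : M 0 = S.residueSolution Dm t z 0)
    (hinf : ∀ᶠ l in Bornology.cobounded ℂ, M l = S.residueSolution Dm t z l) :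
    s.ReconstructedAt Dm t z M ↔ s.q t z = (S.fields Dm).q t z ∧
      s.D t z = (S.fields Dm).D t z ∧ s.P t z = (S.fields Dm).P t z := by
  obtain ⟨hunit, hρ⟩ := isUnit_and_density_at_origin (S := S) Dm t z
  have hlim : Tendsto (fun l : ℂ => (Complex.I * l) • (M l * σ₃ - σ₃ * M l))
      (Bornology.cobounded ℂ) (𝓝 ((S.fields Dm).Q t z)) := by
    refine (solitonMatrix_commutator_tendsto S.lam
      (norming S.lam S.normingConst Dm t z)).congr' ?_
    filter_upwards [hinf] with l hl
    rw [hl]; rfl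
  rw [Fields.ReconstructedAt, h0, hρ]
  constructor
  · rintro ⟨h1, -, h2⟩
    have hQ := tendsto_nhds_unique h1 hlim
    refine ⟨?_, ?_, ?_⟩
    · simpa [Fields.Q] using congrFun (congrFun hQ 0) 1
    · simpa [Fields.ρ] using congrFun (congrFun h2 0) 0
    · simpa [Fields.ρ] using congrFun (congrFun h2 0) 1
  · rintro ⟨h1, h2, h3⟩
    refine ⟨?_, hunit, ?_⟩
    · rw [Fields.Q, h1]; exact hlim
    · rw [Fields.ρ, h2, h3]; rfl

theorem reconstructedAt_iff_of_isResidueSolution {Dm t z : ℝ} {M : ℂ → Mat} (s : Fields)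
    (hM : S.IsResidueSolution Dm t z M) :
    s.ReconstructedAt Dm t z M ↔ s.q t z = (S.fields Dm).q t z ∧
      s.D t z = (S.fields Dm).D t z ∧ s.P t z = (S.fields Dm).P t z := by
  have e := hM.hasResidueConditions.eqOn (S.residueSolution_hasResidueConditions Dm t z)
  refine reconstructedAt_iff s (e S.zero_notMem_poles) ?_
  filter_upwards [S.poles_finite.eventually_cobounded_notMem] with l hl using e hl

/-- The origin and a neighbourhood of infinity lie outside the closed disks, so the radius leaves no
trace in the triple. -/
theorem reconstructedAt_iff_of_isJumpSolution {ε Dm t z : ℝ} {M : ℂ → Mat} (s : Fields)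
    (hε : S.Admissible ε) (hM : S.IsJumpSolution ε Dm t z M) :
    s.ReconstructedAt Dm t z M ↔ s.q t z = (S.fields Dm).q t z ∧
      s.D t z = (S.fields Dm).D t z ∧ s.P t z = (S.fields Dm).P t z := by
  have e := (hM.eq_of_hasResidueConditions hε (S.residueSolution_hasResidueConditions Dm t z)).1
  refine reconstructedAt_iff s (e 0 hε.zero_notMem_disks).symm ?_
  filter_upwards [eventually_notMem_disks ε] with l hl using (e l hl).symm

theorem eq_fields_iff {Dm : ℝ} {s : Fields} : s = S.fields Dm ↔ ∀ t z,
    s.q t z = (S.fields Dm).q t z ∧ s.D t z = (S.fields Dm).D t z ∧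
      s.P t z = (S.fields Dm).P t z := by
  refine ⟨fun h t z => h ▸ ⟨rfl, rfl, rfl⟩, fun h => ?_⟩
  ext t z
  exacts [(h t z).1, (h t z).2.1, (h t z).2.2]

theorem exists_isJumpSolution {ε : ℝ} (hε : S.Admissible ε) (Dm t z : ℝ) :
    ∃ M, S.IsJumpSolution ε Dm t z M :=
  (S.residueSolution_hasResidueConditions Dm t z).exists_isJumpSolution hε

theorem reconstructsFromResidue_iff {Dm : ℝ} {s : Fields} :
    S.ReconstructsFromResidue Dm s ↔ s = S.fields Dm := by
  rw [eq_fields_iff]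
  refine forall₂_congr fun t z => ⟨?_, fun h => ?_⟩
  · rintro ⟨M, hM, hs⟩
    exact (reconstructedAt_iff_of_isResidueSolution s hM).1 hs
  · have hM := S.residueSolution_isResidueSolution Dm t z
    exact ⟨_, hM, (reconstructedAt_iff_of_isResidueSolution s hM).2 h⟩

theorem reconstructsFromJump_iff {ε Dm : ℝ} (hε : S.Admissible ε) {s : Fields} :
    S.ReconstructsFromJump ε Dm s ↔ s = S.fields Dm := by
  rw [eq_fields_iff]
  refine forall₂_congr fun t z => ⟨?_, fun h => ?_⟩
  · rintro ⟨M, hM, hs⟩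
    exact (reconstructedAt_iff_of_isJumpSolution s hε hM).1 hs
  · obtain ⟨M, hM⟩ := exists_isJumpSolution hε Dm t z
    exact ⟨M, hM, (reconstructedAt_iff_of_isJumpSolution s hε hM).2 h⟩

end MBE.SpectralData

theorem lemma1 (S : MBE.SpectralData) (Dm : ℝ) (hDm : Dm = 1 ∨ Dm = -1) :
    -- admissible radii exist
    (∃ ε, S.Admissible ε) ∧
    -- unique solvability of the residue form
    (∀ t z : ℝ, ∃ M, S.IsResidueSolution Dm t z M ∧
      ∀ M', S.IsResidueSolution Dm t z M' → Set.EqOn M' M S.polesᶜ) ∧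
    -- unique solvability of the jump form, for every admissible radius
    (∀ ε, S.Admissible ε → ∀ t z : ℝ, ∃ M, S.IsJumpSolution ε Dm t z M ∧
      ∀ M', S.IsJumpSolution ε Dm t z M' → Set.EqOn M' M (S.contour ε)ᶜ) ∧
    -- correspondence between the solutions of the two forms
    (∀ ε, S.Admissible ε → ∀ (t z : ℝ) (Mr Mj : ℂ → MBE.Mat),
      S.IsResidueSolution Dm t z Mr → S.IsJumpSolution ε Dm t z Mj →
      S.Corresponds ε Dm t z Mr Mj) ∧
    -- the reconstruction formula yields, from either form, one and the same triple, which
    -- solves the Maxwell-Bloch equations with the stated boundary conditions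
    (∃ s : MBE.Fields, s.SolvesMBE ∧ s.HasBoundaryValues Dm ∧
      (∀ s', S.ReconstructsFromResidue Dm s' ↔ s' = s) ∧
      (∀ ε, S.Admissible ε → ∀ s', S.ReconstructsFromJump ε Dm s' ↔ s' = s)) := by
  refine ⟨S.exists_admissible, fun t z => ⟨_, S.residueSolution_isResidueSolution Dm t z,
    fun M' hM' => hM'.hasResidueConditions.eqOn
      (S.residueSolution_hasResidueConditions Dm t z)⟩, fun ε hε t z => ?_,
    fun ε hε t z Mr Mj hr hj => hj.corresponds hε hr.hasResidueConditions,
    S.fields Dm, MBE.solitonFields_solvesMBE S.lam_im_pos _ _,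
    MBE.solitonFields_hasBoundaryValues S.lam_im_pos _ _,
    fun s' => MBE.SpectralData.reconstructsFromResidue_iff,
    fun ε hε s' => MBE.SpectralData.reconstructsFromJump_iff hε⟩
  obtain ⟨M, hM⟩ := MBE.SpectralData.exists_isJumpSolution hε Dm t z
  exact ⟨M, hM, fun M' hM' => hM'.eqOn hM hε⟩
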